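/- Let $p$ be a prime, let $R_p=\widehat{\mathbb Z}_p^{ur}$ (the Witt vectors of an algebraic closure of $\mathbb F_p$) with its Frobenius lift $\phi$, let $\pi$ be a root of a monic Eisenstein polynomial of degree $e\ge 2$ over $\mathbb Z_p$, and let $R_\pi=R_p[\pi]$ with the extension of $\phi$ such that $\phi(\pi)=\pi$. Let $\hat{\ }$ denote $p$-adic completion. For an $R_p$-algebra $A$ let $(A^n)_{n\ge 0}$ be the universal sequence of rings over $R_p$ with $A^0=A$ and with compatible ring maps $A^n\to A^{n+1}$ and $p$-derivations $\delta_p:A^n\to A^{n+1}$ (so $\phi(a)=a^p+p\,\delta_p a$ is a ring homomorphism extending $\phi$ on $R_p$); explicitly, if $A=R_p[x]/I$ then $A^n=R_p[x,\delta_px,\dots,\delta_p^nx]/(I,\delta_pI,\dots,\delta_p^nI)$. For an $R_p$-scheme $V$ let $\mathcal O(J^n_p(V))$ be the ring of families of elements of $\widehat{\mathcal O(W)^n}$, $W\subset V$ affine open, compatible with restriction. Define in the same way, with $\pi$ and $R_\pi$ in place of $p$ and $R_p$ (so $\phi(a)=a^p+\pi\,\delta_\pi a$), the ring $\mathcal O(J^n_\pi(V_{R_\pi}))$,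 using the affine opens $W_{R_\pi}=\mathrm{Spec}(\mathcal O(W)\otimes_{R_p}R_\pi)$. There is a canonical map $$(*)\qquad \mathcal O(J^n_\pi(V_{R_\pi}))\to\mathcal O(J^n_p(V))\otimes_{R_p}R_\pi$$ compatible with the operators $\delta_\pi$, where on the right $\delta_\pi z=(\phi(z)-z^p)/\pi$. An element $f\in\mathcal O(J^n_p(V))$ is called $\delta_\pi$-overconvergent if, for some $\nu\ge 0$, either $p^\nu f$ is in the image of the composition of $(*)$ with $1\otimes \mathrm{Tr}_{R_\pi/R_p}$, or $p^\nu f\otimes 1$ is in the image of $(*)$. Let $V$ be a smooth $R_p$-scheme, let $1\le r\le e-1$, and let $f\in\mathcal O(J^r_p(V))$ be $\delta_\pi$-overconvergent. Then $f$ is $\delta_p$-overconvergent with radius $\ge p^{1/(p^{r-1}e)}$. That is, for every affine open $W\subset V$ and every closed embedding $W\subset\mathbb A^d=\mathrm{Spec}\,R_p[x]$ over $R_p$, the image of $f$ in $\mathcal O(J^r_p(W))$ is the image of a restricted power series $$F=\sum a_{\alpha,\beta}\,x^\alpha y^\beta\in R_p[x,y]\hat{\ }=\mathcal O(J^r_p(\mathbb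 A^d)),\qquad y=(\delta_px,\dots,\delta_p^rx),$$ for which there is a real number $C'>0$ with $v_p(a_{\alpha,\beta})\ge\dfrac{|\beta|}{p^{r-1}e}-C'$ for all $\alpha,\beta$. -/

import Mathlib

noncomputable section

namespace ArithJet

open MvPolynomial TensorProduct

/-- A ring `R` with a non-zero-divisor `unif` dividing `p` and a ring endomorphism `frob` lifting
the `p`-power map modulo `unif`. Such a ring carries the `unif`-derivation
`x ↦ (frob x - x ^ p) / unif`. It is used below only for `R_p` with `unif = p` (`baseP`) and for
`R_π` with `unif = π` (`basePi`). -/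
structure FrobBase (p : ℕ) (R : Type) [CommRing R] where
  unif : R
  frob : R →+* R
  unif_mem : unif ∈ nonZeroDivisors R
  dvd_p : unif ∣ (p : R)
  dvd_frob : ∀ x : R, unif ∣ frob x - x ^ p

/-- The polynomial ring `R[x, δx, …, δⁿx]`, where `x` is the tuple of variables indexed by `σ`;
the variable with index `(i, s)` is `δⁱ x_s`. -/
abbrev JetPoly (R σ : Type) [CommRing R] (n : ℕ) : Type := MvPolynomial (Fin (n + 1) × σ) R

namespace JetPoly

variable {p : ℕ} {R σ τ : Type} [CommRing R]

/-- The inclusion `R[x, …, δⁿx] → R[x, …, δⁿ⁺¹x]`. -/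
def incl (R σ : Type) [CommRing R] (n : ℕ) : JetPoly R σ n →ₐ[R] JetPoly R σ (n + 1) :=
  rename fun s => (s.1.castSucc, s.2)

/-- The ring homomorphism `φ : R[x, …, δⁿx] → R[x, …, δⁿ⁺¹x]` that is `frob` on `R` and sends
`δⁱ x_s` to `(δⁱ x_s) ^ p + c δⁱ⁺¹ x_s`. For `c = unif` the variables stand for the iterates of the
`unif`-derivation; for `R = R_π` and `c = p` they stand for the iterates of the `p`-derivation. -/
def Phi (B : FrobBase p R) (c : R) (σ : Type) (n : ℕ) : JetPoly R σ n →+* JetPoly R σ (n + 1) :=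
  eval₂Hom (C.comp B.frob) fun s => X (s.1.castSucc, s.2) ^ p + C c * X (s.1.succ, s.2)

theorem C_unif_mem (B : FrobBase p R) (ι : Type) :
    (C B.unif : MvPolynomial ι R) ∈ nonZeroDivisors (MvPolynomial ι R) := by
  rw [mem_nonZeroDivisors_iff_right]
  intro F hF
  ext m
  have := congrArg (coeff m) hF
  rw [mul_comm, coeff_C_mul, coeff_zero] at this
  rw [coeff_zero]
  exact (mem_nonZeroDivisors_iff_right.1 B.unif_mem) _ (by rw [mul_comm]; exact this)

theorem cancel (B : FrobBase p R) {ι : Type} {F G : MvPolynomial ι R}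
    (h : C B.unif * F = C B.unif * G) : F = G := by
  have h0 : (F - G) * C B.unif = 0 := by rw [mul_comm, mul_sub, h, sub_self]
  exact sub_eq_zero.1 ((mem_nonZeroDivisors_iff_right.1 (C_unif_mem B ι)) _ h0)

theorem dvd_Phi_sub [Fact p.Prime] (B : FrobBase p R) {c : R} (hc : B.unif ∣ c) (n : ℕ)
    (F : JetPoly R σ n) : C B.unif ∣ Phi B c σ n F - incl R σ n F ^ p := by
  set J : Ideal (JetPoly R σ (n + 1)) := Ideal.span {C B.unif} with hJ
  have hmem : ∀ r : R, B.unif ∣ r → (Ideal.Quotient.mk J (C r)) = 0 := by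
    rintro r ⟨t, rfl⟩
    rw [Ideal.Quotient.eq_zero_iff_mem, C_mul]
    exact Ideal.mul_mem_right _ _ (Ideal.mem_span_singleton_self _)
  have hchar : (p : JetPoly R σ (n + 1) ⧸ J) = 0 := by
    have := hmem _ B.dvd_p
    simpa using this
  have key : ∀ x y : JetPoly R σ (n + 1) ⧸ J, (x + y) ^ p = x ^ p + y ^ p := fun x y => by
    rw [add_pow_prime_eq (Fact.out : p.Prime), hchar, zero_mul, zero_mul,
      zero_mul, add_zero]
  rw [← Ideal.mem_span_singleton, ← Ideal.Quotient.eq_zero_iff_mem, map_sub, map_pow, sub_eq_zero]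
  induction F using MvPolynomial.induction_on with
  | C a =>
    have := hmem _ (B.dvd_frob a)
    rw [C_sub, C_pow, map_sub, map_pow, sub_eq_zero] at this
    simpa [Phi, incl] using this
  | add F G hF hG => rw [map_add, map_add, map_add, map_add, hF, hG, key]
  | mul_X F s hF =>
    rw [map_mul, map_mul, map_mul, map_mul, mul_pow, hF]
    congr 1
    have := hmem _ hc
    rw [Phi, eval₂Hom_X', map_add, map_mul, this, zero_mul, add_zero, map_pow]
    simp [incl]

/-- The `unif`-derivation `F ↦ (φ F - F ^ p) / unif` from `R[x, …, δⁿx]` to `R[x, …, δⁿ⁺¹x]`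
(the quotient is unique since `unif` is a non-zero-divisor, see `unif_mul_delta`). -/
def delta [Fact p.Prime] (B : FrobBase p R) {c : R} (hc : B.unif ∣ c) (n : ℕ)
    (F : JetPoly R σ n) : JetPoly R σ (n + 1) :=
  (dvd_Phi_sub B hc n F).choose

theorem unif_mul_delta [Fact p.Prime] (B : FrobBase p R) {c : R} (hc : B.unif ∣ c) (n : ℕ)
    (F : JetPoly R σ n) : C B.unif * delta B hc n F = Phi B c σ n F - incl R σ n F ^ p :=
  (dvd_Phi_sub B hc n F).choose_spec.symm

/-- The ideal of `R[x, …, δⁿx]` generated by `I, δI, …, δⁿI`, where `I` is an ideal of `R[x]`. -/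
def jetIdeal [Fact p.Prime] (B : FrobBase p R) {c : R} (hc : B.unif ∣ c)
    (I : Ideal (JetPoly R σ 0)) : (n : ℕ) → Ideal (JetPoly R σ n)
  | 0 => I
  | n + 1 => Ideal.span
      (incl R σ n '' (jetIdeal B hc I n : Set (JetPoly R σ n)) ∪
        delta B hc n '' (jetIdeal B hc I n : Set (JetPoly R σ n)))

theorem delta_comm [Fact p.Prime] (B : FrobBase p R) {c c' : R} (hc : B.unif ∣ c)
    (hc' : B.unif ∣ c') (n : ℕ) (f : JetPoly R σ n →ₐ[R] JetPoly R τ n)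
    (g : JetPoly R σ (n + 1) →ₐ[R] JetPoly R τ (n + 1))
    (hi : ∀ F, g (incl R σ n F) = incl R τ n (f F))
    (hP : ∀ F, g (Phi B c σ n F) = Phi B c' τ n (f F)) (F : JetPoly R σ n) :
    g (delta B hc n F) = delta B hc' n (f F) := by
  apply cancel B
  have h1 : (C B.unif : JetPoly R τ (n + 1)) = g (C B.unif) := (g.commutes B.unif).symm
  rw [unif_mul_delta, h1, ← map_mul, unif_mul_delta, map_sub, map_pow, hi, hP]

theorem jetIdeal_le [Fact p.Prime] (B : FrobBase p R) {c c' : R} (hc : B.unif ∣ c)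
    (hc' : B.unif ∣ c') (f : (n : ℕ) → JetPoly R σ n →ₐ[R] JetPoly R τ n)
    (hi : ∀ n F, f (n + 1) (incl R σ n F) = incl R τ n (f n F))
    (hP : ∀ n F, f (n + 1) (Phi B c σ n F) = Phi B c' τ n (f n F))
    {I : Ideal (JetPoly R σ 0)} {I' : Ideal (JetPoly R τ 0)} (h0 : ∀ F ∈ I, f 0 F ∈ I') :
    ∀ n, ∀ F ∈ jetIdeal B hc I n, f n F ∈ jetIdeal B hc' I' n
  | 0 => h0
  | n + 1 => by
    have ih := jetIdeal_le B hc hc' f hi hP h0 n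
    suffices jetIdeal B hc I (n + 1) ≤ (jetIdeal B hc' I' (n + 1)).comap (f (n + 1)) from
      fun F hF => this hF
    refine Ideal.span_le.2 ?_
    rintro _ (⟨F, hF, rfl⟩ | ⟨F, hF, rfl⟩)
    · exact Ideal.subset_span (Or.inl ⟨_, ih F hF, (hi n F).symm⟩)
    · exact Ideal.subset_span (Or.inr ⟨_, ih F hF,
        (delta_comm B hc hc' n (f n) (f (n + 1)) (hi n) (hP n) F).symm⟩)

theorem Phi_incl (B : FrobBase p R) (c : R) (n : ℕ) (F : JetPoly R σ n) :
    Phi B c σ (n + 1) (incl R σ n F) = incl R σ (n + 1) (Phi B c σ n F) := by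
  induction F using MvPolynomial.induction_on with
  | C a => simp [Phi, incl]
  | add F G hF hG => simp only [map_add, hF, hG]
  | mul_X F s hF =>
    rw [map_mul, map_mul, map_mul, map_mul, hF]
    congr 1
    simp [Phi, incl]

theorem delta_incl [Fact p.Prime] (B : FrobBase p R) {c : R} (hc : B.unif ∣ c) (n : ℕ)
    (F : JetPoly R σ n) :
    delta B hc (n + 1) (incl R σ n F) = incl R σ (n + 1) (delta B hc n F) := by
  apply cancel B
  have h1 : (C B.unif : JetPoly R σ (n + 2)) = incl R σ (n + 1) (C B.unif) :=
    ((incl R σ (n + 1)).commutes B.unif).symm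
  rw [unif_mul_delta, h1, ← map_mul, unif_mul_delta, map_sub, map_pow, Phi_incl]

end JetPoly

open JetPoly

section Jet
variable {p : ℕ} [Fact p.Prime] {R : Type} [CommRing R] (B : FrobBase p R)

/-- The ideal of relations of the `R`-algebra `A` in its tautological presentation, with one
variable for each element of `A`. -/
def relIdeal (R A : Type) [CommRing R] [CommRing A] [Algebra R A] : Ideal (JetPoly R A 0) :=
  RingHom.ker (aeval (fun s : Fin 1 × A => s.2) : JetPoly R A 0 →ₐ[R] A)

/-- The `n`-th term `Aⁿ` of the universal `unif`-prolongation sequence over `R` with `A⁰ = A`,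
namely `R[x, …, δⁿx] / (I, δI, …, δⁿI)` for the tautological presentation `A = R[x] / I`.
The class of the variable `(i, a)` is `δⁱ a`. -/
def JetAlg (A : Type) [CommRing A] [Algebra R A] (n : ℕ) : Type :=
  JetPoly R A n ⧸ jetIdeal B (dvd_refl B.unif) (relIdeal R A) n

instance (A : Type) [CommRing A] [Algebra R A] (n : ℕ) : CommRing (JetAlg B A n) :=
  Ideal.Quotient.commRing _

instance (A : Type) [CommRing A] [Algebra R A] (n : ℕ) : Algebra R (JetAlg B A n) :=
  Ideal.Quotient.algebra R

/-- The quotient map `R[x, …, δⁿx] → Aⁿ`. -/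
def JetAlg.mk (A : Type) [CommRing A] [Algebra R A] (n : ℕ) : JetPoly R A n →ₐ[R] JetAlg B A n :=
  Ideal.Quotient.mkₐ R (jetIdeal B (dvd_refl B.unif) (relIdeal R A) n)

theorem JetAlg.mk_eq_zero {A : Type} [CommRing A] [Algebra R A] {n : ℕ} (F : JetPoly R A n) :
    JetAlg.mk B A n F = 0 ↔ F ∈ jetIdeal B (dvd_refl B.unif) (relIdeal R A) n :=
  Ideal.Quotient.eq_zero_iff_mem

variable {A A' : Type} [CommRing A] [Algebra R A] [CommRing A'] [Algebra R A']

/-- Functoriality of the jet algebras: `δⁱ a ↦ δⁱ (u a)`. -/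
def JetAlg.map (u : A →ₐ[R] A') (n : ℕ) : JetAlg B A n →ₐ[R] JetAlg B A' n :=
  Ideal.quotientMapₐ _ (rename fun s : Fin (n + 1) × A => (s.1, u s.2)) <| by
    refine fun F hF => jetIdeal_le B _ _
      (fun n => rename fun s : Fin (n + 1) × A => (s.1, u s.2)) ?_ ?_ ?_ n F hF
    · intro n F
      simp only [incl, rename_rename]; rfl
    · intro n F
      induction F using MvPolynomial.induction_on with
      | C a => simp [Phi]
      | add F G hF hG => simp only [map_add, hF, hG]
      | mul_X F s hF =>
        rw [map_mul, map_mul, map_mul, map_mul, hF]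
        congr 1
        simp [Phi]
    · intro F hF
      rw [relIdeal, RingHom.mem_ker] at hF ⊢
      have : ((aeval fun s : Fin 1 × A' => s.2).comp
          (rename fun s : Fin (0 + 1) × A => (s.1, u s.2)) : JetPoly R A 0 →ₐ[R] A') =
          u.comp (aeval fun s : Fin 1 × A => s.2) := by
        ext s; simp
      have h := DFunLike.congr_fun this F
      simp only [AlgHom.comp_apply] at h
      rw [h, hF, map_zero]

end Jet

section Base
open Polynomial
variable (p : ℕ) [Fact p.Prime]

/-- `R_p`, the completion of the maximal unramified extension of `ℤ_p`, i.e. the ring of Witt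
vectors of an algebraic closure of `𝔽_p`. -/
abbrev Rp : Type := WittVector p (AlgebraicClosure (ZMod p))

/-- The inclusion `ℤ_p → R_p`. -/
def padicToRp : ℤ_[p] →+* Rp p :=
  (WittVector.map (algebraMap (ZMod p) (AlgebraicClosure (ZMod p)))).comp
    (WittVector.equiv p).symm.toRingHom

theorem frob_padicToRp (x : ℤ_[p]) :
    WittVector.frobenius (padicToRp p x) = padicToRp p x := by
  ext n
  rw [WittVector.coeff_frobenius_charP]
  simp only [padicToRp, RingHom.comp_apply, WittVector.map_coeff]
  rw [← map_pow]
  congr 1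
  exact ZMod.pow_card _

theorem padicToRp_injective : Function.Injective (padicToRp p) := by
  have h1 := WittVector.map_injective (p := p) _
    (algebraMap (ZMod p) (AlgebraicClosure (ZMod p))).injective
  exact fun x y h => (WittVector.equiv p).symm.injective (h1 h)

theorem p_dvd_frob_sub (x : Rp p) : (p : Rp p) ∣ WittVector.frobenius x - x ^ p := by
  rw [← Ideal.mem_span_singleton, ← WittVector.ker_constantCoeff, RingHom.mem_ker, map_sub,
    map_pow, sub_eq_zero]
  exact WittVector.coeff_frobenius_charP p x 0

/-- `R_p` with `unif = p` and the Frobenius lift. -/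
def baseP : FrobBase p (Rp p) where
  unif := p
  frob := WittVector.frobenius
  unif_mem := mem_nonZeroDivisors_of_ne_zero (WittVector.p_nonzero p _)
  dvd_p := dvd_rfl
  dvd_frob := p_dvd_frob_sub p

/-- A (monic) Eisenstein polynomial of degree `e ≥ 2` with coefficients in `ℤ_p`. -/
structure EisensteinPoly where
  poly : ℤ_[p][X]
  monic : poly.Monic
  eisenstein : poly.IsEisensteinAt (Ideal.span {(p : ℤ_[p])})
  two_le_natDegree : 2 ≤ poly.natDegree

variable {p} (E : EisensteinPoly p)

/-- The Eisenstein polynomial viewed over `R_p`. -/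
def EisensteinPoly.polyRp : (Rp p)[X] := E.poly.map (padicToRp p)

/-- `R_π = R_p[π]`, where `π` is a root of the Eisenstein polynomial. -/
abbrev Rpi : Type := AdjoinRoot E.polyRp

/-- The element `π` of `R_π`. -/
def Rpi.unif : Rpi E := AdjoinRoot.root _

theorem monic_polyRp : E.polyRp.Monic := E.monic.map _

instance : Module.Free (Rp p) (Rpi E) := (monic_polyRp E).free_adjoinRoot
instance : Module.Finite (Rp p) (Rpi E) := (monic_polyRp E).finite_adjoinRoot

/-- The ring endomorphism `φ` of `R_π` extending the Frobenius of `R_p` with `φ π = π`. -/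
def Rpi.frob : Rpi E →+* Rpi E :=
  AdjoinRoot.lift ((AdjoinRoot.of _).comp WittVector.frobenius) (AdjoinRoot.root _) <| by
    have h : E.polyRp.map WittVector.frobenius = E.polyRp := by
      rw [EisensteinPoly.polyRp, Polynomial.map_map]
      congr 1
      ext x : 1
      exact frob_padicToRp p x
    rw [← Polynomial.eval₂_map, h]
    exact AdjoinRoot.eval₂_root _

theorem Rpi.unif_dvd_coeff_zero :
    Rpi.unif E ∣ algebraMap (Rp p) (Rpi E) (E.polyRp.coeff 0) := by
  have h0 : AdjoinRoot.mk E.polyRp E.polyRp = 0 := AdjoinRoot.mk_self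
  have h1 := congrArg (AdjoinRoot.mk E.polyRp) (Polynomial.X_mul_divX_add E.polyRp)
  rw [h0, map_add, map_mul, AdjoinRoot.mk_X, AdjoinRoot.mk_C] at h1
  exact ⟨-AdjoinRoot.mk E.polyRp E.polyRp.divX, by
    rw [mul_neg, eq_neg_iff_add_eq_zero, add_comm]; exact h1⟩

theorem Rpi.coeff_zero_ne : E.polyRp.coeff 0 ≠ 0 := by
  rw [EisensteinPoly.polyRp, Polynomial.coeff_map]
  intro h
  rw [← map_zero (padicToRp p)] at h
  exact E.eisenstein.notMem (by rw [padicToRp_injective p h]; exact zero_mem _)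

theorem Rpi.unif_dvd_p : Rpi.unif E ∣ (p : Rpi E) := by
  obtain ⟨u, hu⟩ := Ideal.mem_span_singleton.1
    (E.eisenstein.mem (n := 0) (by have := E.two_le_natDegree; omega))
  have hunit : IsUnit u := by
    by_contra hn
    have := (PadicInt.mem_nonunits.1 hn)
    have hd : (p : ℤ_[p]) ∣ u := by
      rw [← Ideal.mem_span_singleton, ← PadicInt.maximalIdeal_eq_span_p]
      exact hn
    apply E.eisenstein.notMem
    rw [Ideal.span_singleton_pow, Ideal.mem_span_singleton, hu, pow_two]
    exact mul_dvd_mul_left _ hd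
  have h := Rpi.unif_dvd_coeff_zero E
  have hc : E.polyRp.coeff 0 = p * padicToRp p u := by
    rw [EisensteinPoly.polyRp, Polynomial.coeff_map, hu, map_mul, map_natCast]
  rw [hc, map_mul, map_natCast] at h
  exact ((hunit.map (padicToRp p)).map (algebraMap (Rp p) (Rpi E))).dvd_mul_right.1 h

theorem Rpi.unif_mem : Rpi.unif E ∈ nonZeroDivisors (Rpi E) := by
  rw [mem_nonZeroDivisors_iff_right]
  intro z hz
  obtain ⟨w, hw⟩ := Rpi.unif_dvd_coeff_zero E
  have h : E.polyRp.coeff 0 • z = 0 := by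
    rw [Algebra.smul_def, hw, mul_right_comm, mul_comm _ z, hz, zero_mul]
  exact (smul_eq_zero.1 h).resolve_left (Rpi.coeff_zero_ne E)

theorem Rpi.dvd_frob (x : Rpi E) : Rpi.unif E ∣ Rpi.frob E x - x ^ p := by
  have hchar : (p : Rpi E ⧸ Ideal.span {Rpi.unif E}) = 0 := by
    have := Ideal.Quotient.eq_zero_iff_mem.2 (Ideal.mem_span_singleton.2 (Rpi.unif_dvd_p E))
    simpa using this
  have key : ∀ x y : Rpi E ⧸ Ideal.span {Rpi.unif E}, (x + y) ^ p = x ^ p + y ^ p :=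
    fun x y => by
      rw [add_pow_prime_eq (Fact.out : p.Prime), hchar, zero_mul, zero_mul, zero_mul, add_zero]
  have hroot : Ideal.Quotient.mk (Ideal.span {Rpi.unif E}) (AdjoinRoot.root E.polyRp) = 0 :=
    Ideal.Quotient.eq_zero_iff_mem.2 (Ideal.mem_span_singleton_self _)
  have hp : p ≠ 0 := (Fact.out : p.Prime).ne_zero
  rw [← Ideal.mem_span_singleton, ← Ideal.Quotient.eq_zero_iff_mem, map_sub, map_pow, sub_eq_zero]
  obtain ⟨F, rfl⟩ := AdjoinRoot.mk_surjective x
  induction F using Polynomial.induction_on with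
  | C a =>
    have h := (map_dvd (algebraMap (Rp p) (Rpi E)) (p_dvd_frob_sub p a))
    rw [map_natCast] at h
    have h2 := Ideal.Quotient.eq_zero_iff_mem.2
      (Ideal.mem_span_singleton.2 ((Rpi.unif_dvd_p E).trans h))
    rw [map_sub, map_sub, map_pow, map_pow, sub_eq_zero] at h2
    rw [AdjoinRoot.mk_C, Rpi.frob, AdjoinRoot.lift_of]
    exact h2
  | add F G hF hG => rw [map_add, map_add, map_add, map_add, hF, hG, key]
  | monomial n a _ =>
    rw [map_mul, map_pow, AdjoinRoot.mk_X, map_mul, map_mul, map_mul, map_pow, map_pow, map_pow, Rpi.frob,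
      AdjoinRoot.lift_root, hroot, zero_pow (Nat.succ_ne_zero n), mul_zero, mul_zero,
      zero_pow hp]

/-- `R_π` with `unif = π` and its Frobenius lift fixing `π`. -/
def basePi : FrobBase p (Rpi E) where
  unif := Rpi.unif E
  frob := Rpi.frob E
  unif_mem := Rpi.unif_mem E
  dvd_p := Rpi.unif_dvd_p E
  dvd_frob := Rpi.dvd_frob E

end Base

section Completion

variable (p : ℕ)

/-- The `p`-adic completion of a ring. -/
abbrev PHat (A : Type) [CommRing A] : Type := AdicCompletion (Ideal.span {(p : A)}) A

theorem span_pow_le_comap {A A' : Type} [CommRing A] [CommRing A'] (u : A →+* A') (m : ℕ) :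
    Ideal.span {(p : A)} ^ m ≤ (Ideal.span {(p : A')} ^ m).comap u := by
  rw [← Ideal.map_le_iff_le_comap, Ideal.map_pow, Ideal.map_span, Set.image_singleton, map_natCast]

/-- The map from the `p`-adic completion of `A` to `A' / p ^ m` induced by `A → A'`. -/
def modPow {A A' : Type} [CommRing A] [CommRing A'] (u : A →+* A') (m : ℕ) :
    PHat p A →+* A' ⧸ Ideal.span {(p : A')} ^ m :=
  (Ideal.quotientMap _ u (span_pow_le_comap p u m)).comp
    (AdicCompletion.evalₐ (Ideal.span {(p : A)}) m : _ →+* _)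

theorem modPow_compat {A A' : Type} [CommRing A] [CommRing A'] (u : A →+* A') {m n : ℕ}
    (h : m ≤ n) :
    (Ideal.Quotient.factorPow (Ideal.span {(p : A')}) h).comp (modPow p u n) = modPow p u m := by
  ext x
  obtain ⟨x, rfl⟩ := AdicCompletion.mk_surjective _ _ x
  simp only [modPow, RingHom.comp_apply, RingHom.coe_coe, AdicCompletion.evalₐ_mk,
    Ideal.quotientMap_mk, Ideal.Quotient.factor_mk]
  rw [← Ideal.quotientMap_mk (H := span_pow_le_comap p u m),
    ← Ideal.quotientMap_mk (H := span_pow_le_comap p u m)]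
  congr 1
  exact AdicCompletion.Ideal.mk_eq_mk _ h x

/-- The canonical map from a ring to its `p`-adic completion. -/
def PHat.of {R A : Type} [CommRing R] [CommRing A] [Algebra R A] : A →ₐ[R] PHat p A where
  toRingHom := algebraMap A (PHat p A)
  commutes' _ := rfl

/-- The map induced on `p`-adic completions. -/
def PHat.map {A A' : Type} [CommRing A] [CommRing A'] (u : A →+* A') : PHat p A →+* PHat p A' :=
  AdicCompletion.liftRingHom _ (modPow p u) (fun h => modPow_compat p u h)

/-- The extension of a ring homomorphism to a `p`-adically complete ring to the completion. -/
def PHat.lift {A A' : Type} [CommRing A] [CommRing A'] [IsAdicComplete (Ideal.span {(p : A')}) A']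
    (u : A →+* A') : PHat p A →+* A' :=
  IsAdicComplete.liftRingHom _ (modPow p u) (fun h => modPow_compat p u h)

theorem smodEq_iff {R M : Type} [CommRing R] [AddCommGroup M] [Module R M] (n : ℕ) (x y : M) :
    x ≡ y [SMOD (Ideal.span {(p : R)} ^ n • ⊤ : Submodule R M)] ↔
      ∃ z : M, x - y = ((p : R) ^ n) • z := by
  rw [SModEq.sub_mem, Ideal.span_singleton_pow, Submodule.ideal_span_singleton_smul,
    Submodule.mem_smul_pointwise_iff_exists]
  exact ⟨fun ⟨z, _, hz⟩ => ⟨z, hz.symm⟩, fun ⟨z, hz⟩ => ⟨z, trivial, hz.symm⟩⟩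

theorem isAdicComplete_span_iff {R A : Type} [CommRing R] [CommRing A] [Algebra R A] :
    IsAdicComplete (Ideal.span {(p : A)}) A ↔ IsAdicComplete (Ideal.span {(p : R)}) A := by
  rw [← IsAdicComplete.map_algebraMap_iff (R := R) (S := A), Ideal.map_span, Set.image_singleton,
    map_natCast]

theorem isAdicComplete_tensor {R S M : Type} [CommRing R] [CommRing S] [Algebra R S]
    [Module.Free R S] [Module.Finite R S] [CommRing M] [Algebra R M]
    [h : IsAdicComplete (Ideal.span {(p : M)}) M] :
    IsAdicComplete (Ideal.span {(p : S ⊗[R] M)}) (S ⊗[R] M) := by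
  rw [isAdicComplete_span_iff (R := R)] at h ⊢
  let e := TensorProduct.equivFinsuppOfBasisLeft (N := M) (Module.Free.chooseBasis R S)
  have hh : IsHausdorff (Ideal.span {(p : R)}) (S ⊗[R] M) := by
    refine ⟨fun x hx => e.injective (Finsupp.ext fun i => ?_)⟩
    rw [map_zero, Finsupp.zero_apply]
    refine h.toIsHausdorff.haus _ fun n => ?_
    obtain ⟨z, hz⟩ := (smodEq_iff p n _ _).1 (hx n)
    rw [sub_zero] at hz
    exact (smodEq_iff p n _ _).2 ⟨e z i, by rw [hz, map_smul, sub_zero, Finsupp.smul_apply]⟩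
  have hp : IsPrecomplete (Ideal.span {(p : R)}) (S ⊗[R] M) := by
    refine ⟨fun f hf => ?_⟩
    have hc : ∀ i, ∃ L : M, ∀ n, e (f n) i ≡ L
        [SMOD (Ideal.span {(p : R)} ^ n • ⊤ : Submodule R M)] := fun i => by
      refine h.toIsPrecomplete.prec (f := fun n => e (f n) i) fun {m n} hmn => ?_
      obtain ⟨z, hz⟩ := (smodEq_iff p m _ _).1 (hf hmn)
      exact (smodEq_iff p m _ _).2 ⟨e z i, by
        rw [← Finsupp.sub_apply, ← map_sub, hz, map_smul, Finsupp.smul_apply]⟩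
    choose L hL using hc
    refine ⟨e.symm (Finsupp.equivFunOnFinite.symm L), fun n => ?_⟩
    have hz : ∀ i, ∃ z : M, e (f n) i - L i = ((p : R) ^ n) • z :=
      fun i => (smodEq_iff p n _ _).1 (hL i n)
    choose z hz using hz
    refine (smodEq_iff p n _ _).2 ⟨e.symm (Finsupp.equivFunOnFinite.symm z), e.injective ?_⟩
    ext i
    simp [hz]
  exact { hh, hp with }

instance PHat.complete (A : Type) [CommRing A] :
    IsAdicComplete (Ideal.span {(p : PHat p A)}) (PHat p A) := by
  rw [isAdicComplete_span_iff (R := A)]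
  exact AdicCompletion.isAdicComplete ⟨{(p : A)}, by simp⟩

end Completion

section Comparison

variable {p : ℕ} [Fact p.Prime] (E : EisensteinPoly p) (A : Type) [CommRing A] [Algebra (Rp p) A]

/-- The presentation `R_π[x] → R_π ⊗ A` with one variable for each element of `A`. -/
def kappa : JetPoly (Rpi E) A 0 →ₐ[Rpi E] Rpi E ⊗[Rp p] A :=
  aeval fun s : Fin 1 × A => (1 : Rpi E) ⊗ₜ[Rp p] s.2

theorem kappa_surjective : Function.Surjective (kappa E A) := by
  intro z
  induction z using TensorProduct.induction_on with
  | zero => exact ⟨0, map_zero _⟩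
  | tmul r a =>
    exact ⟨C r * X (0, a), by
      rw [map_mul, kappa, aeval_X, algHom_C, Algebra.TensorProduct.algebraMap_apply,
        Algebra.TensorProduct.tmul_mul_tmul]
      simp⟩
  | add x y hx hy =>
    obtain ⟨F, rfl⟩ := hx
    obtain ⟨G, rfl⟩ := hy
    exact ⟨F + G, map_add _ _ _⟩

/-- For `b ∈ R_π ⊗ A`, the element `δ_π ⁱ b̃` of `R_π[x, δ_p x, …, δ_p ⁿ x]`, where `b̃ ∈ R_π[x]`
is a lift of `b`. -/
def iterDelta : (n : ℕ) → Fin (n + 1) → (Rpi E ⊗[Rp p] A) → JetPoly (Rpi E) A n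
  | 0, _, b => Function.surjInv (kappa_surjective E A) b
  | n + 1, i, b => Fin.lastCases (delta (basePi E) (basePi E).dvd_p n (iterDelta n (Fin.last n) b))
      (fun j => incl (Rpi E) A n (iterDelta n j b)) i

theorem iterDelta_castSucc (n : ℕ) (j : Fin (n + 1)) (b : Rpi E ⊗[Rp p] A) :
    iterDelta E A (n + 1) j.castSucc b = incl (Rpi E) A n (iterDelta E A n j b) := by
  rw [iterDelta, Fin.lastCases_castSucc]

theorem iterDelta_succ (n : ℕ) (j : Fin (n + 1)) (b : Rpi E ⊗[Rp p] A) :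
    iterDelta E A (n + 1) j.succ b =
      delta (basePi E) (basePi E).dvd_p n (iterDelta E A n j b) := by
  induction n with
  | zero =>
    obtain rfl : j = Fin.last 0 := Subsingleton.elim (α := Fin 1) _ _
    rw [Fin.succ_last]
    exact Fin.lastCases_last
  | succ n ih =>
    induction j using Fin.lastCases with
    | last => rw [Fin.succ_last, iterDelta, Fin.lastCases_last]
    | cast j => rw [Fin.succ_castSucc, iterDelta_castSucc, iterDelta_castSucc, ih, delta_incl]

/-- The map `δ_π ⁱ b ↦ δ_π ⁱ b̃` from polynomials in the `δ_π ⁱ b`, `b ∈ R_π ⊗ A`, to polynomials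
in the `δ_p ⁱ a`, `a ∈ A`, with coefficients in `R_π`. -/
def theta (n : ℕ) :
    JetPoly (Rpi E) (Rpi E ⊗[Rp p] A) n →ₐ[Rpi E] JetPoly (Rpi E) A n :=
  aeval fun s => iterDelta E A n s.1 s.2

theorem theta_mem (n : ℕ) (F : JetPoly (Rpi E) (Rpi E ⊗[Rp p] A) n)
    (hF : F ∈ jetIdeal (basePi E) (dvd_refl _) (relIdeal (Rpi E) (Rpi E ⊗[Rp p] A)) n) :
    theta E A n F ∈ jetIdeal (basePi E) (basePi E).dvd_p (RingHom.ker (kappa E A)) n := by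
  refine jetIdeal_le (basePi E) _ _ (theta E A) ?_ ?_ ?_ n F hF
  · intro n F
    have : (theta E A (n + 1)).comp (incl _ _ n) = (incl _ _ n).comp (theta E A n) := by
      ext s
      simp [theta, incl, iterDelta_castSucc]
    exact DFunLike.congr_fun this F
  · intro n F
    induction F using MvPolynomial.induction_on with
    | C a => simp [Phi, theta, algHom_C, algebraMap_eq]
    | add F G hF hG => simp only [map_add, hF, hG]
    | mul_X F s hF =>
      rw [map_mul, map_mul, map_mul, map_mul, hF]
      congr 1
      have h := unif_mul_delta (basePi E) (basePi E).dvd_p n (iterDelta E A n s.1 s.2)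
      simp only [Phi, theta, eval₂Hom_X', aeval_X, map_add, map_mul, map_pow, iterDelta_castSucc,
        iterDelta_succ, algHom_C, algebraMap_eq] at h ⊢
      rw [h]
      ring
  · intro F hF
    rw [relIdeal, RingHom.mem_ker] at hF
    rw [RingHom.mem_ker, ← hF, ← AlgHom.comp_apply]
    congr 1
    ext s : 1
    simp [theta, iterDelta, Function.surjInv_eq]

/-- Extension of coefficients from `R_p` to `R_π`. -/
def coeffMap (n : ℕ) : JetPoly (Rp p) A n →+* JetPoly (Rpi E) A n :=
  MvPolynomial.map (algebraMap (Rp p) (Rpi E))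

/-- The ideal generated over `R_π` by the relations of the `p`-jet algebra. -/
def extIdeal (n : ℕ) : Ideal (JetPoly (Rpi E) A n) :=
  (jetIdeal (baseP p) (dvd_refl _) (relIdeal (Rp p) A) n).map (coeffMap E A n)

theorem ker_kappa_le : RingHom.ker (kappa E A) ≤ extIdeal E A 0 := by
  intro F hF
  let g : JetPoly (Rp p) A 0 →ₐ[Rp p] A := aeval fun s => s.2
  have hg : Function.Surjective g := fun a => ⟨X (0, a), by simp [g]⟩
  let e := MvPolynomial.algebraTensorAlgEquiv (σ := Fin (0 + 1) × A) (Rp p) (Rpi E)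
  have hk : (Algebra.TensorProduct.map (AlgHom.id (Rpi E) (Rpi E)) g).comp e.symm.toAlgHom =
      kappa E A := by
    ext s
    simp [e, g, kappa]
  have hmem : e.symm F ∈ RingHom.ker (Algebra.TensorProduct.map (AlgHom.id (Rp p) (Rpi E)) g) := by
    rw [← hk] at hF
    exact hF
  rw [Algebra.TensorProduct.lTensor_ker g hg] at hmem
  have h3 : (e.toAlgHom.toRingHom).comp
      (Algebra.TensorProduct.includeRight :
        JetPoly (Rp p) A 0 →ₐ[Rp p] Rpi E ⊗[Rp p] JetPoly (Rp p) A 0).toRingHom =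
      coeffMap E A 0 := by
    ext s
    · simp [e, coeffMap]
    · simp [e, coeffMap]
  have h2 : e.toAlgHom.toRingHom (e.symm F) ∈ Ideal.map e.toAlgHom.toRingHom (Ideal.map
      (Algebra.TensorProduct.includeRight :
        JetPoly (Rp p) A 0 →ₐ[Rp p] Rpi E ⊗[Rp p] JetPoly (Rp p) A 0).toRingHom
      (RingHom.ker g)) := Ideal.mem_map_of_mem _ hmem
  have h4 : e.toAlgHom.toRingHom (e.symm F) = F := e.apply_symm_apply F
  rw [Ideal.map_map, h3, h4] at h2
  exact h2

theorem incl_coeffMap (n : ℕ) (F : JetPoly (Rp p) A n) :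
    incl (Rpi E) A n (coeffMap E A n F) = coeffMap E A (n + 1) (incl (Rp p) A n F) :=
  (MvPolynomial.map_rename _ _ _).symm

theorem Phi_coeffMap (n : ℕ) (F : JetPoly (Rp p) A n) :
    Phi (basePi E) p A n (coeffMap E A n F) =
      coeffMap E A (n + 1) (Phi (baseP p) (baseP p).unif A n F) := by
  induction F using MvPolynomial.induction_on with
  | C a =>
    simp only [Phi, coeffMap, MvPolynomial.map_C, coe_eval₂Hom, eval₂_C, RingHom.comp_apply]
    congr 1
    change Rpi.frob E (AdjoinRoot.of _ a) = _
    rw [Rpi.frob, AdjoinRoot.lift_of]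
    rfl
  | add F G hF hG => simp only [map_add, hF, hG]
  | mul_X F s hF =>
    rw [map_mul, map_mul, map_mul, map_mul, hF]
    congr 1
    simp [Phi, coeffMap, baseP]

theorem delta_coeffMap_mem (n : ℕ) {F : JetPoly (Rp p) A n}
    (hF : F ∈ jetIdeal (baseP p) (dvd_refl _) (relIdeal (Rp p) A) n) :
    delta (basePi E) (basePi E).dvd_p n (coeffMap E A n F) ∈ extIdeal E A (n + 1) := by
  obtain ⟨w, hw⟩ := (basePi E).dvd_p
  have h : delta (basePi E) (basePi E).dvd_p n (coeffMap E A n F) =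
      C w * coeffMap E A (n + 1) (delta (baseP p) (dvd_refl _) n F) := by
    apply cancel (basePi E)
    have h1 : coeffMap E A (n + 1) (C (baseP p).unif) = C (basePi E).unif * C w := by
      rw [← C_mul, ← hw]
      simp [coeffMap, baseP]
    rw [← mul_assoc, ← h1, ← map_mul, unif_mul_delta, unif_mul_delta, map_sub, map_pow,
      Phi_coeffMap, incl_coeffMap]
  rw [h]
  exact Ideal.mul_mem_left _ _ (Ideal.mem_map_of_mem _
    (Ideal.subset_span (Or.inr ⟨F, hF, rfl⟩)))

theorem extIdeal_stable (n : ℕ) {F : JetPoly (Rpi E) A n} (hF : F ∈ extIdeal E A n) :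
    incl (Rpi E) A n F ∈ extIdeal E A (n + 1) ∧
      delta (basePi E) (basePi E).dvd_p n F ∈ extIdeal E A (n + 1) := by
  have hi : ∀ G ∈ extIdeal E A n, incl (Rpi E) A n G ∈ extIdeal E A (n + 1) := by
    suffices extIdeal E A n ≤ (extIdeal E A (n + 1)).comap (incl (Rpi E) A n) from
      fun G hG => this hG
    refine Ideal.map_le_iff_le_comap.2 fun G hG => ?_
    change incl (Rpi E) A n (coeffMap E A n G) ∈ extIdeal E A (n + 1)
    rw [incl_coeffMap]
    exact Ideal.mem_map_of_mem _ (Ideal.subset_span (Or.inl ⟨G, hG, rfl⟩))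
  refine ⟨hi F hF, ?_⟩
  obtain ⟨w, hw⟩ := (basePi E).dvd_p
  have h0 : delta (basePi E) (basePi E).dvd_p n (0 : JetPoly (Rpi E) A n) = 0 := by
    apply cancel (basePi E)
    rw [unif_mul_delta, map_zero, map_zero, mul_zero, zero_pow (Fact.out : p.Prime).ne_zero,
      sub_zero]
  have hmul : ∀ a G : JetPoly (Rpi E) A n, delta (basePi E) (basePi E).dvd_p n (a * G) =
      Phi (basePi E) p A n a * delta (basePi E) (basePi E).dvd_p n G +
        delta (basePi E) (basePi E).dvd_p n a * incl (Rpi E) A n G ^ p := by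
    intro a G
    apply cancel (basePi E)
    rw [mul_add, mul_left_comm, unif_mul_delta, ← mul_assoc (C _), unif_mul_delta, unif_mul_delta,
      map_mul, map_mul, mul_pow]
    ring
  have hadd : ∀ G H : JetPoly (Rpi E) A n, ∃ t, delta (basePi E) (basePi E).dvd_p n (G + H) =
      delta (basePi E) (basePi E).dvd_p n G + delta (basePi E) (basePi E).dvd_p n H +
        incl (Rpi E) A n G * t := by
    intro G H
    have hq := add_pow_prime_eq (Fact.out : p.Prime) (incl (Rpi E) A n G) (incl (Rpi E) A n H)
    have hpw : (p : JetPoly (Rpi E) A (n + 1)) = C (basePi E).unif * C w := by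
      rw [← C_mul, ← hw, map_natCast]
    rw [hpw] at hq
    refine ⟨-(C w * incl (Rpi E) A n H * ∑ k ∈ Finset.Ioo 0 p, incl (Rpi E) A n G ^ (k - 1) *
      incl (Rpi E) A n H ^ (p - k - 1) * (p.choose k / p : ℕ)), ?_⟩
    apply cancel (basePi E)
    rw [mul_add, mul_add, unif_mul_delta, unif_mul_delta, unif_mul_delta, map_add, map_add, hq]
    ring
  have main : ∀ G ∈ extIdeal E A n,
      delta (basePi E) (basePi E).dvd_p n G ∈ extIdeal E A (n + 1) := by
    intro G hG
    refine Submodule.span_induction (p := fun G _ =>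
      delta (basePi E) (basePi E).dvd_p n G ∈ extIdeal E A (n + 1)) ?_ ?_ ?_ ?_ hG
    · rintro _ ⟨G, hG, rfl⟩
      exact delta_coeffMap_mem E A n hG
    · rw [h0]; exact zero_mem _
    · intro G H hG _ hdG hdH
      obtain ⟨t, ht⟩ := hadd G H
      rw [ht]
      exact add_mem (add_mem hdG hdH) (Ideal.mul_mem_right _ _ (hi G hG))
    · intro a G hG hdG
      rw [smul_eq_mul, hmul]
      exact add_mem (Ideal.mul_mem_left _ _ hdG) (Ideal.mul_mem_left _ _
        (Ideal.pow_mem_of_mem _ (hi G hG) p (Fact.out : p.Prime).pos))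
  exact main F hF

theorem jetIdeal_le_extIdeal : ∀ n,
    jetIdeal (basePi E) (basePi E).dvd_p (RingHom.ker (kappa E A)) n ≤ extIdeal E A n
  | 0 => ker_kappa_le E A
  | n + 1 => by
    have ih := jetIdeal_le_extIdeal n
    refine Ideal.span_le.2 ?_
    rintro _ (⟨F, hF, rfl⟩ | ⟨F, hF, rfl⟩)
    · exact (extIdeal_stable E A n (ih hF)).1
    · exact (extIdeal_stable E A n (ih hF)).2

/-- The projection `R_π[x, δ_p x, …, δ_p ⁿ x] → R_π ⊗ Aⁿ`. -/
def toTensor (n : ℕ) : JetPoly (Rpi E) A n →ₐ[Rpi E] Rpi E ⊗[Rp p] JetAlg (baseP p) A n :=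
  aeval fun s => (1 : Rpi E) ⊗ₜ[Rp p] JetAlg.mk (baseP p) A n (X s)

theorem extIdeal_le_ker (n : ℕ) : extIdeal E A n ≤ RingHom.ker (toTensor E A n) := by
  refine Ideal.map_le_iff_le_comap.2 fun F hF => ?_
  have h : (toTensor E A n).toRingHom.comp (coeffMap E A n) =
      (Algebra.TensorProduct.includeRight :
        JetAlg (baseP p) A n →ₐ[Rp p] Rpi E ⊗[Rp p] JetAlg (baseP p) A n).toRingHom.comp
        (JetAlg.mk (baseP p) A n).toRingHom := by
    ext s
    · change toTensor E A n (MvPolynomial.map _ (C s)) =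
        (1 : Rpi E) ⊗ₜ[Rp p] JetAlg.mk (baseP p) A n (C s)
      rw [MvPolynomial.map_C, algHom_C, algHom_C, Algebra.TensorProduct.algebraMap_apply,
        Algebra.algebraMap_self_apply, Algebra.algebraMap_eq_smul_one, TensorProduct.smul_tmul,
        Algebra.algebraMap_eq_smul_one]
    · simp [toTensor, coeffMap]
  have h2 := DFunLike.congr_fun h F
  have h3 : (JetAlg.mk (baseP p) A n).toRingHom F = 0 := (JetAlg.mk_eq_zero _ F).2 hF
  rw [RingHom.comp_apply, RingHom.comp_apply, h3, map_zero] at h2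
  exact h2

/-- The morphism of `π`-prolongation sequences from the `π`-jet algebras of `R_π ⊗ A` to
`R_π ⊗ Aⁿ`, where `Aⁿ` are the `p`-jet algebras of `A`: it sends `δ_π ⁱ b` to the `i`-th iterate of
`z ↦ (φ z - z ^ p) / π` on `b`. -/
def toPJetAlg (n : ℕ) :
    JetAlg (basePi E) (Rpi E ⊗[Rp p] A) n →ₐ[Rpi E] Rpi E ⊗[Rp p] JetAlg (baseP p) A n :=
  Ideal.Quotient.liftₐ _ ((toTensor E A n).comp (theta E A n)) fun F hF =>
    extIdeal_le_ker E A n (jetIdeal_le_extIdeal E A n (theta_mem E A n F hF))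

instance tensor_complete (D : Type) [CommRing D] [Algebra (Rp p) D] :
    IsAdicComplete (Ideal.span {(p : Rpi E ⊗[Rp p] PHat p D)}) (Rpi E ⊗[Rp p] PHat p D) :=
  isAdicComplete_tensor p

/-- The canonical map `𝒪(J_π ⁿ(X_{R_π})) → 𝒪(J_p ⁿ(X)) ⊗ R_π` for `X = Spec A`. -/
def toPJet (n : ℕ) :
    PHat p (JetAlg (basePi E) (Rpi E ⊗[Rp p] A) n) →+*
      Rpi E ⊗[Rp p] PHat p (JetAlg (baseP p) A n) :=
  PHat.lift p
    ((Algebra.TensorProduct.map (AlgHom.id (Rp p) (Rpi E))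
      (PHat.of p : JetAlg (baseP p) A n →ₐ[Rp p] PHat p (JetAlg (baseP p) A n))).toRingHom.comp
      (toPJetAlg E A n).toRingHom)

/-- The map `1 ⊗ Tr : 𝒪(J_p ⁿ(X)) ⊗ R_π → 𝒪(J_p ⁿ(X))` for `X = Spec A`. -/
def arithTrace (n : ℕ) :
    Rpi E ⊗[Rp p] PHat p (JetAlg (baseP p) A n) →ₗ[Rp p] PHat p (JetAlg (baseP p) A n) :=
  (TensorProduct.lid (Rp p) _).toLinearMap ∘ₗ
    LinearMap.rTensor _ (Algebra.trace (Rp p) (Rpi E))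

end Comparison

section Series

variable {p : ℕ} [Fact p.Prime] {σ : Type}

/-- A power series is restricted if its coefficients tend to `0` `p`-adically. -/
def IsRestrictedSeries (F : MvPowerSeries σ (Rp p)) : Prop :=
  ∀ m : ℕ, {α : σ →₀ ℕ | ¬ (p : Rp p) ^ m ∣ MvPowerSeries.coeff α F}.Finite

/-- The finite sum of the terms of a restricted series not divisible by `p ^ m`. -/
def truncSeries (F : MvPowerSeries σ (Rp p)) (hF : IsRestrictedSeries F) (m : ℕ) :
    MvPolynomial σ (Rp p) :=
  ∑ α ∈ (hF m).toFinset, monomial α (MvPowerSeries.coeff α F)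

/-- A restricted power series as an element of the `p`-adically completed polynomial ring. -/
def IsRestrictedSeries.toPHat {F : MvPowerSeries σ (Rp p)} (hF : IsRestrictedSeries F) :
    PHat p (MvPolynomial σ (Rp p)) :=
  AdicCompletion.mk _ _ ⟨truncSeries F hF, by
    classical
    intro m n hmn
    rw [smodEq_iff]
    have hd : ∀ α ∈ (hF n).toFinset \ (hF m).toFinset,
        (p : MvPolynomial σ (Rp p)) ^ m ∣ monomial α (MvPowerSeries.coeff α F) := by
      intro α hα
      rw [Finset.mem_sdiff, Set.Finite.mem_toFinset, Set.Finite.mem_toFinset, Set.mem_ofPred_eq,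
        Set.mem_ofPred_eq, not_not] at hα
      obtain ⟨t, ht⟩ := hα.2
      refine ⟨monomial α t, ?_⟩
      rw [ht, ← C_mul_monomial, map_pow, map_natCast]
    obtain ⟨z, hz⟩ := Finset.dvd_sum hd
    have hsub : (hF m).toFinset ⊆ (hF n).toFinset := by
      intro α hα
      rw [Set.Finite.mem_toFinset, Set.mem_ofPred_eq] at hα ⊢
      exact fun h => hα ((pow_dvd_pow _ hmn).trans h)
    refine ⟨-z, ?_⟩
    rw [smul_eq_mul, mul_neg, ← hz, truncSeries, truncSeries, ← Finset.sum_sdiff hsub]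
    ring⟩

/-- A series `∑ a_{α,β} x^α y^β`, where `x` are the variables with index `(0, j)` and `y` (standing
for `δ_p x, …, δ_p ʳ x`) are the others, is overconvergent in `y` with radius `≥ ρ = p ^ C` if
`v_p(a_{α,β}) ≥ C |β| - C'` for some constant `C' > 0`. Here `v_p(a) ≥ t` is expressed by `p ^ v ∣ a`
for some natural number `v ≥ t`. -/
def IsOverconvergentSeries {r d : ℕ} (ρ : ℝ) (F : MvPowerSeries (Fin (r + 1) × Fin d) (Rp p)) :
    Prop :=
  ∃ C' : ℝ, 0 < C' ∧ ∀ α : Fin (r + 1) × Fin d →₀ ℕ, ∃ v : ℕ,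
    Real.logb p ρ * ((α.sum fun s k => if s.1 = 0 then 0 else k : ℕ) : ℝ) - C' ≤ v ∧
      (p : Rp p) ^ v ∣ MvPowerSeries.coeff α F

end Series

section Schemes

open AlgebraicGeometry CategoryTheory

variable {R : Type} [CommRing R] {V : Scheme.{0}} (s : V ⟶ Spec (CommRingCat.of R))

/-- The sections of `𝒪_V` over `W`, as an algebra over the base ring through `V ⟶ Spec R`. -/
def Sec (_ : V ⟶ Spec (CommRingCat.of R)) (W : V.Opens) : Type := Γ(V, W)

instance (W : V.Opens) : CommRing (Sec s W) := inferInstanceAs (CommRing Γ(V, W))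

instance (W : V.Opens) : Algebra R (Sec s W) :=
  RingHom.toAlgebra
    ((Scheme.ΓSpecIso (CommRingCat.of R)).inv ≫ s.appTop ≫
      V.presheaf.map (homOfLE (le_top : W ≤ ⊤)).op).hom

/-- Restriction of sections. -/
def Sec.res {W W' : V.Opens} (h : W' ≤ W) : Sec s W →ₐ[R] Sec s W' where
  toRingHom := (V.presheaf.map (homOfLE h).op).hom
  commutes' r := by
    have h1 : V.presheaf.map (homOfLE (le_top : W ≤ ⊤)).op ≫ V.presheaf.map (homOfLE h).op =
        V.presheaf.map (homOfLE (le_top : W' ≤ ⊤)).op := by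
      rw [← Functor.map_comp]
      rfl
    change (((Scheme.ΓSpecIso (CommRingCat.of R)).inv ≫ s.appTop ≫
      V.presheaf.map (homOfLE (le_top : W ≤ ⊤)).op) ≫ V.presheaf.map (homOfLE h).op).hom r =
      ((Scheme.ΓSpecIso (CommRingCat.of R)).inv ≫ s.appTop ≫
        V.presheaf.map (homOfLE (le_top : W' ≤ ⊤)).op).hom r
    rw [Category.assoc, Category.assoc, h1]

end Schemes

section Jets

open AlgebraicGeometry CategoryTheory

variable {p : ℕ} [Fact p.Prime] {V : Scheme.{0}} (s : V ⟶ Spec (CommRingCat.of (Rp p)))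
  (E : EisensteinPoly p)

/-- The ring `𝒪(J_p ⁿ(V))` of global functions on the `p`-jet space: the `p`-jet space is glued from
`J_p ⁿ(W) = Spf` of the completed jet algebra of `𝒪(W)`, `W ⊆ V` affine open, so a global function
is a family of elements of these rings that is compatible with restriction. -/
def pJetFunctions (n : ℕ) :
    Subring ((W : V.affineOpens) → PHat p (JetAlg (baseP p) (Sec s W.1) n)) where
  carrier := {f | ∀ (W W' : V.affineOpens) (h : W'.1 ≤ W.1),
    PHat.map p (JetAlg.map (baseP p) (Sec.res s h) n).toRingHom (f W) = f W'}
  zero_mem' W W' h := map_zero _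
  one_mem' W W' h := map_one _
  add_mem' hf hg W W' h := by rw [Pi.add_apply, map_add, hf W W' h, hg W W' h]; rfl
  mul_mem' hf hg W W' h := by rw [Pi.mul_apply, map_mul, hf W W' h, hg W W' h]; rfl
  neg_mem' hf W W' h := by rw [Pi.neg_apply, map_neg, hf W W' h]; rfl

/-- The ring `𝒪(J_π ⁿ(V_{R_π}))` of global functions on the `π`-jet space of `V_{R_π}`, which is
covered by the `π`-jet spaces of the affine open subschemes `W_{R_π} = Spec (R_π ⊗ 𝒪(W))`,
`W ⊆ V` affine open. -/
def piJetFunctions (n : ℕ) :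
    Subring ((W : V.affineOpens) → PHat p (JetAlg (basePi E) (Rpi E ⊗[Rp p] Sec s W.1) n)) where
  carrier := {g | ∀ (W W' : V.affineOpens) (h : W'.1 ≤ W.1),
    PHat.map p (JetAlg.map (basePi E)
      (Algebra.TensorProduct.map (AlgHom.id (Rpi E) (Rpi E)) (Sec.res s h)) n).toRingHom (g W) =
      g W'}
  zero_mem' W W' h := map_zero _
  one_mem' W W' h := map_one _
  add_mem' hf hg W W' h := by rw [Pi.add_apply, map_add, hf W W' h, hg W W' h]; rfl
  mul_mem' hf hg W W' h := by rw [Pi.mul_apply, map_mul, hf W W' h, hg W W' h]; rfl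
  neg_mem' hf W W' h := by rw [Pi.neg_apply, map_neg, hf W W' h]; rfl

/-- `f` is `δ_π`-overconvergent: some multiple `p ^ ν f` is in the image of the trace map
`𝒪(J_π ⁿ(V_{R_π})) → 𝒪(J_p ⁿ(V)) ⊗ R_π → 𝒪(J_p ⁿ(V))`, or (equivalently, when `ℚ_p(π)/ℚ_p` is Galois)
some multiple `p ^ ν f` is in the image of `𝒪(J_π ⁿ(V_{R_π})) → 𝒪(J_p ⁿ(V)) ⊗ R_π`. -/
def IsDeltaPiOverconvergent {n : ℕ} (f : pJetFunctions s n) : Prop :=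
  (∃ (ν : ℕ) (g : piJetFunctions s E n), ∀ W : V.affineOpens,
    arithTrace E (Sec s W.1) n (toPJet E (Sec s W.1) n (g.1 W)) = (p : PHat p _) ^ ν * f.1 W) ∨
  (∃ (ν : ℕ) (g : piJetFunctions s E n), ∀ W : V.affineOpens,
    toPJet E (Sec s W.1) n (g.1 W) = 1 ⊗ₜ[Rp p] ((p : PHat p _) ^ ν * f.1 W))

/-- The map `R_p[x, δ_p x, …, δ_p ⁿ x]^ = 𝒪(J_p ⁿ(𝔸^d)) → 𝒪(J_p ⁿ(Spec A))` induced by the morphism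
`Spec A → 𝔸^d` with coordinates `x`; it sends `δ_p ⁱ x_j` to `δ_p ⁱ (x j)`. -/
def affineJetMap {A : Type} [CommRing A] [Algebra (Rp p) A] {d : ℕ} (x : Fin d → A) (n : ℕ) :
    PHat p (MvPolynomial (Fin (n + 1) × Fin d) (Rp p)) →+* PHat p (JetAlg (baseP p) A n) :=
  PHat.map p (aeval fun t : Fin (n + 1) × Fin d =>
    JetAlg.mk (baseP p) A n (X (t.1, x t.2))).toRingHom

/-- The coordinate functions on `W` of a morphism `W ⟶ 𝔸^d`. -/
def embCoord (W : V.Opens) {d : ℕ}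
    (j : (W : Scheme) ⟶ 𝔸(Fin d; Spec (CommRingCat.of (Rp p)))) (i : Fin d) : Sec s W :=
  W.topIso.hom (j.appTop (AffineSpace.coord (Spec (CommRingCat.of (Rp p))) i))

/-- `f` is `δ_p`-overconvergent with radius `≥ ρ`: for each affine open `W ⊆ V` and each closed
embedding of `W` in an affine space over `R_p`, the image of `f` in `𝒪(J_p ⁿ(W))` is the image of a
restricted power series that is overconvergent in `δ_p x, …, δ_p ⁿ x` with radius `≥ ρ`. -/
def IsDeltaPOverconvergent {n : ℕ} (ρ : ℝ) (f : pJetFunctions s n) : Prop :=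
  ∀ (W : V.affineOpens) (d : ℕ)
    (j : (W.1 : Scheme) ⟶ 𝔸(Fin d; Spec (CommRingCat.of (Rp p)))),
    IsClosedImmersion j →
    j ≫ (𝔸(Fin d; Spec (CommRingCat.of (Rp p))) ↘ Spec (CommRingCat.of (Rp p))) = W.1.ι ≫ s →
    ∃ (F : MvPowerSeries (Fin (n + 1) × Fin d) (Rp p)) (hF : IsRestrictedSeries F),
      IsOverconvergentSeries ρ F ∧
        affineJetMap (embCoord s W.1 j) n hF.toPHat = f.1 W

end Jets

end ArithJet

end

/-!
Since `φ` fixes `π` and `p` is `π ^ e` up to a unit, computing `δ_π` in terms of `δ_p` over `R_π`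
shows that `δ_π ⁱ x_j`, for `1 ≤ i ≤ e - 1`, is `π ^ (e - i)` times a polynomial of degree at most
`p ^ (i - 1)` in the `δ_p ˡ x_j`. A function on the `π`-jet space is a `p`-adically convergent sum
of polynomials in the `δ_π ⁱ x_j`, so in terms of the `δ_p ˡ x_j` its coefficient at a monomial of
degree `b` in the `δ_p ˡ x_j`, `l ≥ 1`, is divisible by `π` to the power `⌈b / p ^ (r - 1)⌉`. An
`R_p`-linear functional on `R_π`, the trace or one that maps `1` to `1`, turns this into a
`p`-divisibility of order about `b / (p ^ (r - 1) e)`. The result is a lift of `p ^ ν f` that is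
overconvergent; by Artin–Rees it differs from `p ^ ν` times a suitable lift of `f` by a polynomial,
which does not affect overconvergence.
-/

noncomputable section

namespace ArithJet

open MvPolynomial TensorProduct

section AdicSums

/-- `x = ∑ pᵏ zₖ` in the `p`-adic topology, which is not assumed to be separated or complete. -/
def HasAdicSum {S : Type} [CommRing S] (p : ℕ) (z : ℕ → S) (x : S) : Prop :=
  ∀ n, (p : S) ^ n ∣ x - ∑ k ∈ Finset.range n, (p : S) ^ k * z k

variable {p : ℕ} {S S' : Type} [CommRing S] [CommRing S'] {z : ℕ → S} {x y : S}

theorem eq_of_forall_pow_dvd_sub [IsHausdorff (Ideal.span {(p : S)}) S]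
    (h : ∀ n, (p : S) ^ n ∣ x - y) : x = y :=
  (IsHausdorff.eq_iff_smodEq (I := Ideal.span {(p : S)})).2 fun n => (smodEq_iff p n x y).2 (h n)

theorem map_natCast_pow_mul (M : S →+ S') (n : ℕ) (x : S) :
    M ((p : S) ^ n * x) = (p : S') ^ n * M x := by
  simp only [← Nat.cast_pow, ← nsmul_eq_mul, map_nsmul]

theorem natCast_pow_dvd_map (M : S →+ S') {n : ℕ} (h : (p : S) ^ n ∣ x) : (p : S') ^ n ∣ M x := by
  obtain ⟨t, rfl⟩ := h
  exact ⟨M t, map_natCast_pow_mul M n t⟩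

namespace HasAdicSum

theorem of_forall_eq_zero (hz : ∀ k, z k = 0) : HasAdicSum p z 0 := fun n => by simp [hz]

theorem unique [IsHausdorff (Ideal.span {(p : S)}) S] (hx : HasAdicSum p z x)
    (hy : HasAdicSum p z y) : x = y :=
  eq_of_forall_pow_dvd_sub (p := p) fun n => by simpa using dvd_sub (hx n) (hy n)

theorem map (M : S →+ S') (hx : HasAdicSum p z x) : HasAdicSum p (fun k => M (z k)) (M x) :=
  fun n => by simpa [map_natCast_pow_mul] using natCast_pow_dvd_map M (hx n)

theorem pow_dvd {m : ℕ} (hx : HasAdicSum p z x) (h : ∀ k, (p : S) ^ m ∣ (p : S) ^ k * z k) :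
    (p : S) ^ m ∣ x :=
  (dvd_iff_dvd_of_dvd_sub (hx m)).2 (Finset.dvd_sum fun k _ => h k)

end HasAdicSum

theorem pow_dvd_sum_range_sub {m n : ℕ} (h : m ≤ n) (z : ℕ → S) :
    (p : S) ^ m ∣ ∑ k ∈ Finset.range m, (p : S) ^ k * z k -
      ∑ k ∈ Finset.range n, (p : S) ^ k * z k := by
  rw [← Finset.sum_range_add_sum_Ico _ h, sub_add_cancel_left, dvd_neg]
  exact Finset.dvd_sum fun k hk => (pow_dvd_pow _ (Finset.mem_Ico.1 hk).1).mul_right _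

theorem exists_hasAdicSum (p : ℕ) [IsPrecomplete (Ideal.span {(p : S)}) S] (z : ℕ → S) :
    ∃ x, HasAdicSum p z x := by
  obtain ⟨x, hx⟩ := IsPrecomplete.prec ‹_› (I := Ideal.span {(p : S)})
    (f := fun n => ∑ k ∈ Finset.range n, (p : S) ^ k * z k)
    fun hmn => (smodEq_iff p _ _ _).2 (pow_dvd_sum_range_sub hmn z)
  exact ⟨x, fun n => dvd_sub_comm.1 ((smodEq_iff p n _ _).1 (hx n))⟩

end AdicSums

namespace PHat

variable {p : ℕ} {A A' : Type} [CommRing A] [CommRing A']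

theorem pow_dvd_iff_evalₐ_eq_zero {n : ℕ} {x : PHat p A} :
    (p : PHat p A) ^ n ∣ x ↔ AdicCompletion.evalₐ (Ideal.span {(p : A)}) n x = 0 := by
  refine ⟨?_, fun h => ?_⟩
  · rintro ⟨t, rfl⟩
    rw [map_mul, map_pow, map_natCast, ← map_natCast (Ideal.Quotient.mk _), ← map_pow,
      Ideal.Quotient.eq_zero_iff_mem.2 (Ideal.pow_mem_pow (Ideal.mem_span_singleton_self _) n),
      zero_mul]
  · obtain ⟨c, rfl⟩ := AdicCompletion.mk_surjective _ _ x
    rw [AdicCompletion.evalₐ_mk, Ideal.Quotient.eq_zero_iff_mem] at h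
    have hmem : AdicCompletion.mk _ _ c ∈
        (Ideal.span {(p : A)} ^ n • ⊤ : Submodule A (PHat p A)) := by
      rw [AdicCompletion.pow_smul_top_eq_ker_eval (Submodule.fg_span_singleton _)]
      exact (Submodule.Quotient.mk_eq_zero _).2 (by simpa using h)
    rw [← sub_zero (AdicCompletion.mk _ _ c), ← SModEq.sub_mem, smodEq_iff, sub_zero] at hmem
    obtain ⟨t, ht⟩ := hmem
    exact ⟨t, by rw [ht, Algebra.smul_def, map_pow, map_natCast]⟩

theorem pow_dvd_algebraMap_iff {n : ℕ} {a : A} :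
    (p : PHat p A) ^ n ∣ algebraMap A (PHat p A) a ↔ (p : A) ^ n ∣ a := by
  rw [pow_dvd_iff_evalₐ_eq_zero, AlgHom.commutes, Ideal.Quotient.algebraMap_eq,
    Ideal.Quotient.eq_zero_iff_mem, Ideal.span_singleton_pow, Ideal.mem_span_singleton]

theorem exists_pow_dvd_sub_algebraMap (n : ℕ) (x : PHat p A) :
    ∃ a : A, (p : PHat p A) ^ n ∣ x - algebraMap A (PHat p A) a := by
  obtain ⟨a, ha⟩ := Ideal.Quotient.mk_surjective (AdicCompletion.evalₐ (Ideal.span {(p : A)}) n x)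
  refine ⟨a, pow_dvd_iff_evalₐ_eq_zero.2 ?_⟩
  rw [map_sub, AlgHom.commutes, Ideal.Quotient.algebraMap_eq, ha, sub_self]

theorem exists_hasAdicSum_algebraMap (x : PHat p A) :
    ∃ z : ℕ → A, HasAdicSum p (fun k => algebraMap A (PHat p A) (z k)) x := by
  choose a ha using fun x : PHat p A => exists_pow_dvd_sub_algebraMap 1 x
  choose q hq using ha
  refine ⟨fun k => a (q^[k] x), fun n => ⟨q^[n] x, ?_⟩⟩
  induction n with
  | zero => simp
  | succ n ih =>
    have hn := hq (q^[n] x)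
    rw [pow_one, ← Function.iterate_succ_apply' q n x] at hn
    rw [Finset.sum_range_succ, ← sub_sub, ih, ← mul_sub, hn, pow_succ, mul_assoc]

theorem map_algebraMap (u : A →+* A') (a : A) :
    map p u (algebraMap A _ a) = algebraMap A' _ (u a) := by
  refine AdicCompletion.ext_evalₐ fun n => ?_
  simp only [map, AdicCompletion.evalₐ_liftRingHom, modPow, RingHom.comp_apply, RingHom.coe_coe,
    AlgHom.commutes, Ideal.Quotient.algebraMap_eq, Ideal.quotientMap_mk]

theorem lift_algebraMap [IsAdicComplete (Ideal.span {(p : A')}) A'] (u : A →+* A') (a : A) :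
    lift p u (algebraMap A _ a) = u a := by
  refine eq_of_forall_pow_dvd_sub (p := p) fun n => ?_
  rw [← Ideal.mem_span_singleton, ← Ideal.span_singleton_pow, ← Ideal.Quotient.eq, lift,
    IsAdicComplete.mk_liftRingHom]
  simp only [modPow, RingHom.comp_apply, RingHom.coe_coe,
    AlgHom.commutes, Ideal.Quotient.algebraMap_eq, Ideal.quotientMap_mk]

theorem map_surjective {u : A →+* A'} (hu : Function.Surjective u) :
    Function.Surjective (map p u) := by
  intro x
  obtain ⟨w, hx⟩ := exists_hasAdicSum_algebraMap x
  choose z hz using fun k => hu (w k)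
  obtain ⟨y, hy⟩ := exists_hasAdicSum p fun k => algebraMap A (PHat p A) (z k)
  refine ⟨y, HasAdicSum.unique ?_ hx⟩
  simpa only [RingHom.toAddMonoidHom_eq_coe, AddMonoidHom.coe_coe, map_algebraMap, hz] using
    hy.map (map p u).toAddMonoidHom

theorem exists_mem_ker_pow_dvd_sub {u : A →+* A'} (hu : Function.Surjective u) {x : PHat p A}
    (hx : map p u x = 0) (n : ℕ) :
    ∃ a ∈ RingHom.ker u, (p : PHat p A) ^ n ∣ x - algebraMap A (PHat p A) a := by
  obtain ⟨a, ha⟩ := exists_pow_dvd_sub_algebraMap n x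
  have hua : (p : A') ^ n ∣ u a := by
    have h := natCast_pow_dvd_map (map p u).toAddMonoidHom ha
    simpa [hx, map_algebraMap, pow_dvd_algebraMap_iff] using h
  obtain ⟨b, hb⟩ := hua
  obtain ⟨t, rfl⟩ := hu b
  refine ⟨a - (p : A) ^ n * t, by simp [RingHom.mem_ker, hb], ?_⟩
  rw [map_sub, sub_sub_eq_add_sub, add_sub_right_comm, map_mul, map_pow, map_natCast]
  exact dvd_add ha (dvd_mul_right _ _)

end PHat

theorem exists_forall_mem_mul_of_pow_dvd {A : Type} [CommRing A] [IsNoetherianRing A] (q : A)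
    (I : Ideal A) : ∃ c, ∀ n, ∀ a ∈ I, q ^ (n + c) ∣ a → ∃ t ∈ I, a = q ^ n * t := by
  obtain ⟨c, hc⟩ := Ideal.exists_pow_inf_eq_pow_smul (Ideal.span {q}) (I : Submodule A A)
  refine ⟨c, fun n a ha hqa => ?_⟩
  have hmem : a ∈ (Ideal.span {q} ^ (n + c) • ⊤ ⊓ I : Submodule A A) :=
    ⟨by simpa [Ideal.span_singleton_pow, Ideal.mem_span_singleton] using hqa, ha⟩
  rw [hc _ (Nat.le_add_left c n), Nat.add_sub_cancel, Ideal.span_singleton_pow,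
    Submodule.ideal_span_singleton_smul, Submodule.mem_smul_pointwise_iff_exists] at hmem
  obtain ⟨t, ht, rfl⟩ := hmem
  exact ⟨t, ht.2, rfl⟩

theorem PHat.exists_eq_add_of_map_eq_zero {p : ℕ} {A A' : Type} [CommRing A] [CommRing A']
    [IsNoetherianRing A] {u : A →+* A'} (hu : Function.Surjective u) {x : PHat p A}
    (hx : map p u x = 0) (ν : ℕ) :
    ∃ a ∈ RingHom.ker u, ∃ y : PHat p A, map p u y = 0 ∧
      x = algebraMap A _ a + (p : PHat p A) ^ ν * y := by
  obtain ⟨c, hc⟩ := exists_forall_mem_mul_of_pow_dvd (p : A) (RingHom.ker u)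
  choose j hju hj using fun n => exists_mem_ker_pow_dvd_sub hu hx (n + (ν + c))
  have hstep (n : ℕ) : ∃ t ∈ RingHom.ker u, j (n + 1) - j n = (p : A) ^ (n + ν) * t := by
    refine hc _ _ (sub_mem (hju _) (hju _)) (pow_dvd_algebraMap_iff.1 ?_)
    have h := dvd_sub (hj n) ((pow_dvd_pow _ (by omega)).trans (hj (n + 1)))
    rwa [sub_sub_sub_cancel_left, ← map_sub, ← add_assoc] at h
  choose t htu ht using hstep
  obtain ⟨y, hy⟩ := exists_hasAdicSum p fun k => algebraMap A (PHat p A) (t k)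
  refine ⟨j 0, hju 0, y, HasAdicSum.unique (hy.map (map p u).toAddMonoidHom) ?_, ?_⟩
  · exact HasAdicSum.of_forall_eq_zero fun k => by
      simp [map_algebraMap, RingHom.mem_ker.1 (htu k)]
  · refine eq_of_forall_pow_dvd_sub (p := p) fun n => ?_
    have hjn : j n = j 0 + (p : A) ^ ν * ∑ k ∈ Finset.range n, (p : A) ^ k * t k := by
      rw [← sub_eq_iff_eq_add', ← Finset.sum_range_sub, Finset.mul_sum]
      exact Finset.sum_congr rfl fun k _ => by rw [ht, pow_add]; ring
    have h := dvd_sub ((pow_dvd_pow _ (Nat.le_add_right _ _)).trans (hj n))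
      ((hy n).mul_left ((p : PHat p A) ^ ν))
    convert h using 1
    simp only [hjn, map_add, map_mul, map_pow, map_natCast, map_sum]
    ring

section RestrictedSeries

theorem isAdicComplete_pi (p : ℕ) {R ι : Type} [CommRing R] {M : ι → Type}
    [∀ i, AddCommGroup (M i)] [∀ i, Module R (M i)]
    [h : ∀ i, IsAdicComplete (Ideal.span {(p : R)}) (M i)] :
    IsAdicComplete (Ideal.span {(p : R)}) (∀ i, M i) := by
  have hsub {n : ℕ} {x y : ∀ i, M i}
      (hxy : x ≡ y [SMOD (Ideal.span {(p : R)} ^ n • ⊤ : Submodule R (∀ i, M i))]) (i : ι) :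
      x i ≡ y i [SMOD (Ideal.span {(p : R)} ^ n • ⊤ : Submodule R (M i))] := by
    obtain ⟨z, hz⟩ := (smodEq_iff p n _ _).1 hxy
    exact (smodEq_iff p n _ _).2 ⟨z i, congrFun hz i⟩
  refine { haus' x hx := funext fun i => ?_, prec' f hf := ?_ }
  · exact (h i).toIsHausdorff.haus _ fun n => hsub (hx n) i
  · choose L hL using fun i =>
      (h i).toIsPrecomplete.prec (f := fun n => f n i) fun hmn => hsub (hf hmn) i
    refine ⟨L, fun n => (smodEq_iff p n _ _).2 ?_⟩
    choose z hz using fun i => (smodEq_iff p n _ _).1 (hL i n)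
    exact ⟨z, funext hz⟩

instance isAdicComplete_mvPowerSeries {p : ℕ} {R σ : Type} [CommRing R]
    [IsAdicComplete (Ideal.span {(p : R)}) R] :
    IsAdicComplete (Ideal.span {(p : MvPowerSeries σ R)}) (MvPowerSeries σ R) :=
  (isAdicComplete_span_iff p (R := R)).2 (isAdicComplete_pi p (M := fun _ : σ →₀ ℕ => R))

theorem natCast_pow_dvd_iff_coeff {p : ℕ} {R σ : Type} [CommRing R] {n : ℕ} {P : MvPolynomial σ R} :
    (p : MvPolynomial σ R) ^ n ∣ P ↔ ∀ α, (p : R) ^ n ∣ coeff α P := by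
  rw [← C_dvd_iff_dvd_coeff, map_pow, map_natCast]

variable {p : ℕ} [Fact p.Prime] {σ : Type}

/-- The expansion of an element of the completed polynomial ring as a power series, by which this
ring is identified with the ring of restricted series. -/
def PHat.toSeries : PHat p (MvPolynomial σ (Rp p)) →+* MvPowerSeries σ (Rp p) :=
  PHat.lift p coeToMvPowerSeries.ringHom

theorem PHat.toSeries_algebraMap (P : MvPolynomial σ (Rp p)) :
    PHat.toSeries (algebraMap _ (PHat p (MvPolynomial σ (Rp p))) P) = P :=
  PHat.lift_algebraMap _ P

theorem PHat.pow_dvd_coeff_toSeries_sub {x : PHat p (MvPolynomial σ (Rp p))} {n : ℕ}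
    {P : MvPolynomial σ (Rp p)} (h : (p : PHat p _) ^ n ∣ x - algebraMap _ _ P) (α : σ →₀ ℕ) :
    (p : Rp p) ^ n ∣ MvPowerSeries.coeff α (PHat.toSeries x) - coeff α P := by
  have := natCast_pow_dvd_map
    ((MvPowerSeries.coeff α).toAddMonoidHom.comp PHat.toSeries.toAddMonoidHom) h
  simpa [PHat.toSeries_algebraMap] using this

theorem HasAdicSum.coeff_toSeries {z : ℕ → MvPolynomial σ (Rp p)}
    {x : PHat p (MvPolynomial σ (Rp p))} (hx : HasAdicSum p (fun k => algebraMap _ _ (z k)) x)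
    (α : σ →₀ ℕ) :
    HasAdicSum p (fun k => coeff α (z k)) (MvPowerSeries.coeff α (PHat.toSeries x)) := by
  simpa [PHat.toSeries_algebraMap] using
    hx.map ((MvPowerSeries.coeff α).toAddMonoidHom.comp PHat.toSeries.toAddMonoidHom)

theorem PHat.toSeries_injective :
    Function.Injective (PHat.toSeries : PHat p (MvPolynomial σ (Rp p)) →+* _) := by
  refine (injective_iff_map_eq_zero _).2 fun x hx => ?_
  refine eq_of_forall_pow_dvd_sub (p := p) fun n => ?_
  obtain ⟨P, hP⟩ := PHat.exists_pow_dvd_sub_algebraMap n x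
  have hPn : (p : MvPolynomial σ (Rp p)) ^ n ∣ P := natCast_pow_dvd_iff_coeff.2 fun α => by
    simpa [hx] using PHat.pow_dvd_coeff_toSeries_sub hP α
  rw [sub_zero]
  exact (dvd_iff_dvd_of_dvd_sub hP).2 (PHat.pow_dvd_algebraMap_iff.2 hPn)

theorem isRestrictedSeries_toSeries (x : PHat p (MvPolynomial σ (Rp p))) :
    IsRestrictedSeries (PHat.toSeries x) := by
  intro n
  obtain ⟨P, hP⟩ := PHat.exists_pow_dvd_sub_algebraMap n x
  refine P.support.finite_toSet.subset fun α hα => ?_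
  rw [Finset.mem_coe, mem_support_iff]
  intro h0
  exact hα (by simpa [h0] using PHat.pow_dvd_coeff_toSeries_sub hP α)

namespace IsRestrictedSeries

variable {F : MvPowerSeries σ (Rp p)}

theorem pow_dvd_coeff_truncSeries_sub (hF : IsRestrictedSeries F) (n : ℕ) (α : σ →₀ ℕ) :
    (p : Rp p) ^ n ∣ coeff α (truncSeries F hF n) - MvPowerSeries.coeff α F := by
  classical
  simp only [truncSeries, coeff_sum, coeff_monomial, Finset.sum_ite_eq', Set.Finite.mem_toFinset,
    Set.mem_ofPred_eq]
  split_ifs with h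
  · simpa using h
  · simp

theorem pow_dvd_toPHat_sub_truncSeries (hF : IsRestrictedSeries F) (n : ℕ) :
    (p : PHat p _) ^ n ∣ hF.toPHat - algebraMap _ _ (truncSeries F hF n) := by
  rw [PHat.pow_dvd_iff_evalₐ_eq_zero, map_sub, AlgHom.commutes, sub_eq_zero]
  exact AdicCompletion.evalₐ_mk _ _ _

theorem toSeries_toPHat (hF : IsRestrictedSeries F) : PHat.toSeries hF.toPHat = F := by
  ext α : 1
  refine eq_of_forall_pow_dvd_sub (p := p) fun n => ?_
  simpa using dvd_add (PHat.pow_dvd_coeff_toSeries_sub (hF.pow_dvd_toPHat_sub_truncSeries n) α)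
    (hF.pow_dvd_coeff_truncSeries_sub n α)

end IsRestrictedSeries

theorem toPHat_toSeries (x : PHat p (MvPolynomial σ (Rp p))) :
    (isRestrictedSeries_toSeries x).toPHat = x :=
  PHat.toSeries_injective (isRestrictedSeries_toSeries x).toSeries_toPHat

end RestrictedSeries

section Overconvergence

/-- The weights for which a monomial in the jet variables has as its weight the degree in the
variables standing for `δⁱ x`, `i ≥ 1`, that is, the exponent `|β|` of `x ^ α y ^ β`. -/
def derWeight (n : ℕ) (σ : Type) : Fin (n + 1) × σ → ℕ :=
  fun s => if s.1 = 0 then 0 else 1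

theorem weight_derWeight {n : ℕ} {σ : Type} (α : Fin (n + 1) × σ →₀ ℕ) :
    Finsupp.weight (derWeight n σ) α = α.sum fun s k => if s.1 = 0 then 0 else k := by
  simp only [Finsupp.weight_apply, derWeight, smul_eq_mul, mul_ite, mul_zero, mul_one]

theorem weight_derWeight_le_degree {n : ℕ} {σ : Type} (α : Fin (n + 1) × σ →₀ ℕ) :
    Finsupp.weight (derWeight n σ) α ≤ α.degree := by
  rw [weight_derWeight, Finsupp.degree_apply]
  exact Finset.sum_le_sum fun s _ => by
    change (if s.1 = 0 then 0 else α s) ≤ α s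
    split_ifs <;> simp

variable {p : ℕ} [Fact p.Prime] {r d : ℕ} {ρ : ℝ}
  {F G : MvPowerSeries (Fin (r + 1) × Fin d) (Rp p)}

theorem isOverconvergentSeries_iff : IsOverconvergentSeries ρ F ↔ ∃ C' : ℝ, 0 < C' ∧
    ∀ α, ∃ v : ℕ, Real.logb p ρ * Finsupp.weight (derWeight r (Fin d)) α - C' ≤ v ∧
      (p : Rp p) ^ v ∣ MvPowerSeries.coeff α F := by
  simp only [IsOverconvergentSeries, weight_derWeight]

theorem isOverconvergentSeries_coe (P : MvPolynomial (Fin (r + 1) × Fin d) (Rp p)) :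
    IsOverconvergentSeries ρ (P : MvPowerSeries (Fin (r + 1) × Fin d) (Rp p)) := by
  refine isOverconvergentSeries_iff.2
    ⟨|Real.logb p ρ| * P.totalDegree + 1, by positivity, fun α => ?_⟩
  rw [coeff_coe]
  by_cases hα : coeff α P = 0
  · obtain ⟨v, hv⟩ := exists_nat_ge
      (Real.logb p ρ * Finsupp.weight (derWeight r (Fin d)) α -
        (|Real.logb p ρ| * P.totalDegree + 1))
    exact ⟨v, hv, hα ▸ dvd_zero _⟩
  · refine ⟨0, ?_, by simp⟩
    have hdeg : Finsupp.weight (derWeight r (Fin d)) α ≤ P.totalDegree :=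
      (weight_derWeight_le_degree α).trans
        (le_totalDegree (mem_support_iff.2 hα))
    have h : Real.logb p ρ * Finsupp.weight (derWeight r (Fin d)) α ≤
        |Real.logb p ρ| * P.totalDegree :=
      mul_le_mul (le_abs_self _) (Nat.cast_le.2 hdeg) (Nat.cast_nonneg _) (abs_nonneg _)
    push_cast
    linarith

namespace IsOverconvergentSeries

theorem add (hF : IsOverconvergentSeries ρ F) (hG : IsOverconvergentSeries ρ G) :
    IsOverconvergentSeries ρ (F + G) := by
  obtain ⟨C₁, hC₁, h₁⟩ := hF
  obtain ⟨C₂, -, h₂⟩ := hG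
  refine ⟨max C₁ C₂, lt_max_of_lt_left hC₁, fun α => ?_⟩
  obtain ⟨v₁, hv₁, hF⟩ := h₁ α
  obtain ⟨v₂, hv₂, hG⟩ := h₂ α
  refine ⟨min v₁ v₂, ?_, ?_⟩
  · rw [Nat.cast_min]
    exact le_min ((sub_le_sub_left (le_max_left _ _) _).trans hv₁)
      ((sub_le_sub_left (le_max_right _ _) _).trans hv₂)
  · rw [map_add]
    exact dvd_add ((pow_dvd_pow _ (min_le_left _ _)).trans hF)
      ((pow_dvd_pow _ (min_le_right _ _)).trans hG)

theorem of_pow_mul {ν : ℕ} (h : IsOverconvergentSeries ρ ((p : MvPowerSeries _ _) ^ ν * F)) :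
    IsOverconvergentSeries ρ F := by
  obtain ⟨C', hC', h⟩ := h
  refine ⟨C' + ν, by positivity, fun α => ?_⟩
  obtain ⟨v, hv, hdvd⟩ := h α
  refine ⟨v - ν, ?_, ?_⟩
  · have hle : (v : ℝ) ≤ (v - ν : ℕ) + ν := by exact_mod_cast (by omega)
    linarith
  · have hcoeff : MvPowerSeries.coeff α ((p : MvPowerSeries _ (Rp p)) ^ ν * F) =
        (p : Rp p) ^ ν * MvPowerSeries.coeff α F :=
      map_natCast_pow_mul (MvPowerSeries.coeff α).toAddMonoidHom ν F
    rw [hcoeff] at hdvd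
    rcases le_total ν v with hν | hν
    · rw [← Nat.add_sub_of_le hν, pow_add] at hdvd
      exact (mul_dvd_mul_iff_left (pow_ne_zero ν (WittVector.p_nonzero p _))).1 hdvd
    · simp [Nat.sub_eq_zero_of_le hν]

end IsOverconvergentSeries

end Overconvergence

namespace JetPoly

variable {p : ℕ} {R σ τ : Type} [CommRing R] (B : FrobBase p R) {c : R}

theorem Phi_C (n : ℕ) (a : R) : Phi B c σ n (C a) = C (B.frob a) := eval₂Hom_C _ _ _

theorem Phi_X (n : ℕ) (s : Fin (n + 1) × σ) :
    Phi B c σ n (X s) = X (s.1.castSucc, s.2) ^ p + C c * X (s.1.succ, s.2) :=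
  eval₂Hom_X' _ _ _

theorem incl_C (n : ℕ) (a : R) : incl R σ n (C a) = C a := rename_C _ _

theorem incl_X (n : ℕ) (s : Fin (n + 1) × σ) : incl R σ n (X s) = X (s.1.castSucc, s.2) :=
  rename_X _ _

theorem totalDegree_incl_le (n : ℕ) (F : JetPoly R σ n) :
    (incl R σ n F).totalDegree ≤ F.totalDegree :=
  totalDegree_rename_le _ _

/-- The map of jet polynomials induced by a map of variables. -/
def ren (R : Type) [CommRing R] (v : σ → τ) (n : ℕ) : JetPoly R σ n →ₐ[R] JetPoly R τ n :=
  rename fun s => (s.1, v s.2)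

theorem ren_X (v : σ → τ) (n : ℕ) (s : Fin (n + 1) × σ) :
    ren R v n (X s) = X (s.1, v s.2) := rename_X _ _

theorem ren_incl (v : σ → τ) (n : ℕ) (F : JetPoly R σ n) :
    ren R v (n + 1) (incl R σ n F) = incl R τ n (ren R v n F) := by
  simp only [ren, incl, rename_rename]
  rfl

theorem ren_Phi (v : σ → τ) (n : ℕ) (F : JetPoly R σ n) :
    ren R v (n + 1) (Phi B c σ n F) = Phi B c τ n (ren R v n F) := by
  induction F using MvPolynomial.induction_on with
  | C a => simp only [ren, Phi_C, rename_C]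
  | add F G hF hG => simp only [map_add, hF, hG]
  | mul_X F s hF => simp only [map_mul, hF, ren_X, Phi_X, map_add, map_pow, algHom_C, algebraMap_eq]

theorem totalDegree_Phi_le [Fact p.Prime] (n : ℕ) (F : JetPoly R σ n) :
    (Phi B c σ n F).totalDegree ≤ p * F.totalDegree := by
  have hX (s : Fin (n + 1) × σ) : (X (s.1.castSucc, s.2) ^ p + C c * X (s.1.succ, s.2) :
      JetPoly R σ (n + 1)).totalDegree ≤ p := by
    rw [X_pow_eq_monomial, C_mul_X_eq_monomial]
    refine (totalDegree_add _ _).trans (max_le ?_ ?_) <;>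
      refine (totalDegree_monomial_le _ _).trans (Finsupp.sum_single_index rfl).le |>.trans ?_
    · exact le_rfl
    · exact (Fact.out : p.Prime).one_le
  conv_lhs => rw [F.as_sum, map_sum]
  refine totalDegree_finsetSum_le fun α hα => ?_
  rw [Phi, eval₂Hom_monomial, RingHom.comp_apply]
  refine (totalDegree_mul _ _).trans ?_
  rw [totalDegree_C, zero_add]
  refine (totalDegree_finsetProd _ _).trans
    (le_trans ?_ (Nat.mul_le_mul_left p (le_totalDegree hα)))
  rw [Finsupp.sum, Finset.mul_sum]
  refine Finset.sum_le_sum fun s _ => (totalDegree_pow _ _).trans ?_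
  rw [mul_comm]
  exact Nat.mul_le_mul_right _ (hX s)

variable [Fact p.Prime] (hc : B.unif ∣ c)

theorem ren_delta (v : σ → τ) (n : ℕ) (F : JetPoly R σ n) :
    ren R v (n + 1) (delta B hc n F) = delta B hc n (ren R v n F) :=
  delta_comm B hc hc n _ _ (ren_incl v n) (ren_Phi B v n) F

theorem delta_X {a : R} (ha : c = B.unif * a) (n : ℕ) (s : Fin (n + 1) × σ) :
    delta B hc n (X s) = C a * X (s.1.succ, s.2) := by
  apply cancel B
  rw [unif_mul_delta, Phi_X, incl_X, add_sub_cancel_left, ha, C_mul, mul_assoc]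

theorem exists_delta_add_eq (n : ℕ) (G H : JetPoly R σ n) :
    ∃ t, delta B hc n (G + H) = delta B hc n G + delta B hc n H + incl R σ n G * t := by
  obtain ⟨w, hw⟩ := B.dvd_p
  have hpw : (p : JetPoly R σ (n + 1)) = C B.unif * C w := by
    rw [← C_mul, ← hw, map_natCast]
  have hpow := add_pow_prime_eq (Fact.out : p.Prime) (incl R σ n G) (incl R σ n H)
  rw [hpw] at hpow
  refine ⟨-(C w * incl R σ n H * ∑ k ∈ Finset.Ioo 0 p, incl R σ n G ^ (k - 1) *
    incl R σ n H ^ (p - k - 1) * (p.choose k / p : ℕ)), ?_⟩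
  apply cancel B
  rw [mul_add, mul_add, unif_mul_delta, unif_mul_delta, unif_mul_delta, map_add, map_add, hpow]
  ring

/-- A sequence of ideals stable under the inclusions and under `δ`, so that `δ` descends to the
quotients. -/
structure IsDeltaStable (I : ∀ n, Ideal (JetPoly R σ n)) : Prop where
  incl_mem : ∀ {n F}, F ∈ I n → incl R σ n F ∈ I (n + 1)
  delta_mem : ∀ {n F}, F ∈ I n → delta B hc n F ∈ I (n + 1)

theorem isDeltaStable_jetIdeal (I : Ideal (JetPoly R σ 0)) :
    IsDeltaStable B hc (jetIdeal B hc I) where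
  incl_mem hF := Ideal.subset_span (Or.inl ⟨_, hF, rfl⟩)
  delta_mem hF := Ideal.subset_span (Or.inr ⟨_, hF, rfl⟩)

/-- The iterate `δⁱ F`, as an element of `R[x, …, δⁿx]`, of a polynomial `F ∈ R[x]`. -/
def deltaIter : (n : ℕ) → Fin (n + 1) → JetPoly R σ 0 → JetPoly R σ n
  | 0, _, F => F
  | n + 1, i, F => Fin.cases (incl R σ n (deltaIter n 0 F))
      (fun j => delta B hc n (deltaIter n j F)) i

theorem deltaIter_zero (n : ℕ) (F : JetPoly R σ 0) :
    deltaIter B hc (n + 1) 0 F = incl R σ n (deltaIter B hc n 0 F) := rfl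

theorem deltaIter_succ (n : ℕ) (j : Fin (n + 1)) (F : JetPoly R σ 0) :
    deltaIter B hc (n + 1) j.succ F = delta B hc n (deltaIter B hc n j F) := rfl

theorem deltaIter_zero_X (n : ℕ) (s : σ) : deltaIter B hc n 0 (X (0, s)) = X (0, s) := by
  induction n with
  | zero => rfl
  | succ n ih => rw [deltaIter_zero, ih, incl_X, Fin.castSucc_zero]

theorem deltaIter_X (n : ℕ) (i : Fin (n + 1)) (s : σ) :
    deltaIter B (dvd_refl B.unif) n i (X (0, s)) = X (i, s) := by
  induction n with
  | zero => rw [Subsingleton.elim (α := Fin 1) i 0]; rfl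
  | succ n ih =>
    cases i using Fin.cases with
    | zero => exact deltaIter_zero_X B _ _ s
    | succ j => rw [deltaIter_succ, ih, delta_X B _ (mul_one _).symm, C_1, one_mul]

theorem ren_deltaIter (v : σ → τ) (n : ℕ) (i : Fin (n + 1)) (F : JetPoly R σ 0) :
    ren R v n (deltaIter B hc n i F) = deltaIter B hc n i (ren R v 0 F) := by
  induction n with
  | zero => rfl
  | succ n ih =>
    cases i using Fin.cases with
    | zero => simp only [deltaIter_zero, ren_incl, ih]
    | succ j => simp only [deltaIter_succ, ren_delta, ih]

namespace IsDeltaStable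

variable {B hc} {I : ∀ n, Ideal (JetPoly R σ n)}

theorem delta_sub_mem (hI : IsDeltaStable B hc I) {n : ℕ} {G H : JetPoly R σ n}
    (h : G - H ∈ I n) : delta B hc n G - delta B hc n H ∈ I (n + 1) := by
  obtain ⟨t, ht⟩ := exists_delta_add_eq B hc n (G - H) H
  rw [sub_add_cancel] at ht
  rw [ht, add_sub_right_comm, add_sub_cancel_right]
  exact add_mem (hI.delta_mem h) (Ideal.mul_mem_right _ _ (hI.incl_mem h))

theorem deltaIter_sub_mem (hI : IsDeltaStable B hc I) {F G : JetPoly R σ 0} (h : F - G ∈ I 0)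
    (n : ℕ) (i : Fin (n + 1)) : deltaIter B hc n i F - deltaIter B hc n i G ∈ I n := by
  induction n with
  | zero => exact h
  | succ n ih =>
    cases i using Fin.cases with
    | zero =>
      rw [deltaIter_zero, deltaIter_zero, ← map_sub]
      exact hI.incl_mem (ih 0)
    | succ j => exact hI.delta_sub_mem (ih j)

end IsDeltaStable

section RamifiedGrowth

variable {B}

theorem delta_C_unif_pow_mul (hfrob : B.frob B.unif = B.unif) (n m : ℕ) (Q : JetPoly R σ n) :
    delta B hc n (C (B.unif ^ (m + 1)) * Q) = C (B.unif ^ m) *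
      (Phi B c σ n Q - C (B.unif ^ ((m + 1) * (p - 1))) * incl R σ n Q ^ p) := by
  apply cancel B
  have hexp : (m + 1) * p = m + 1 + (m + 1) * (p - 1) := by
    rw [← mul_one_add, Nat.add_sub_of_le (Fact.out : p.Prime).one_le]
  rw [unif_mul_delta, map_mul, map_mul, Phi_C, incl_C, map_pow, hfrob, mul_pow, ← C_pow, ← pow_mul,
    hexp, pow_add _ (m + 1), C_mul, pow_succ', C_mul]
  ring

/-- If `unif ^ e` divides `c`, each further application of `δ` loses one factor `unif` and raises
the degree by a factor at most `p`. -/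
theorem exists_deltaIter_succ_X_eq (hfrob : B.frob B.unif = B.unif) {e : ℕ}
    (he : B.unif ^ e ∣ c) (s : σ) {n : ℕ} (k : Fin n) (hk : (k : ℕ) < e) :
    ∃ Q : JetPoly R σ n, deltaIter B hc n k.succ (X (0, s)) = C (B.unif ^ (e - (k + 1))) * Q ∧
      Q.totalDegree ≤ p ^ (k : ℕ) := by
  induction n with
  | zero => exact k.elim0
  | succ n ih =>
    cases k using Fin.cases with
    | zero =>
      obtain ⟨w, hw⟩ := he
      refine ⟨C w * X (1, s), ?_, ?_⟩
      · rw [deltaIter_succ, deltaIter_zero_X, delta_X B hc (a := B.unif ^ (e - 1) * w), C_mul,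
          mul_assoc]
        · rfl
        · rw [hw, ← mul_assoc, ← pow_succ', Nat.sub_add_cancel (show 1 ≤ e from hk)]
      · rw [C_mul_X_eq_monomial]
        exact (totalDegree_monomial_le _ _).trans (Finsupp.sum_single_index rfl).le
    | succ k =>
      obtain ⟨Q, hQ, hdeg⟩ := ih k (Nat.lt_of_succ_lt hk)
      rw [Fin.val_succ] at hk ⊢
      obtain ⟨m, hm⟩ : ∃ m, e - (k + 1) = m + 1 := ⟨e - (k + 1 + 1), by omega⟩
      obtain rfl : m = e - (k + 1 + 1) := by omega
      refine ⟨_, by rw [deltaIter_succ, hQ, hm, delta_C_unif_pow_mul hc hfrob],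
        (totalDegree_sub _ _).trans (max_le ?_ ?_)⟩
      · rw [pow_succ']
        exact (totalDegree_Phi_le B _ _).trans (Nat.mul_le_mul_left _ hdeg)
      · refine (totalDegree_mul _ _).trans ?_
        rw [totalDegree_C, zero_add, pow_succ']
        exact (totalDegree_pow _ _).trans
          (Nat.mul_le_mul_left _ ((totalDegree_incl_le _ _).trans hdeg))

end RamifiedGrowth

end JetPoly

open JetPoly

section JetCoordinates

variable {p : ℕ} [Fact p.Prime] {R σ : Type} [CommRing R] (B : FrobBase p R)
  {A : Type} [CommRing A] [Algebra R A] (y : σ → A)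

/-- The map `R[x, …, δⁿx] → Aⁿ`, `δⁱ x_s ↦ δⁱ y_s`, given by elements `y_s` of `A`. -/
def jetCoord (n : ℕ) : JetPoly R σ n →ₐ[R] JetAlg B A n :=
  aeval fun t => JetAlg.mk B A n (X (t.1, y t.2))

theorem jetCoord_X (n : ℕ) (t : Fin (n + 1) × σ) :
    jetCoord B y n (X t) = JetAlg.mk B A n (X (t.1, y t.2)) := aeval_X _ _

theorem jetCoord_apply (n : ℕ) (F : JetPoly R σ n) :
    jetCoord B y n F = JetAlg.mk B A n (ren R y n F) := by
  have h : jetCoord B y n = (JetAlg.mk B A n).comp (ren R y n) := by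
    ext t
    simp only [AlgHom.comp_apply, jetCoord_X, ren_X]
  rw [h, AlgHom.comp_apply]

variable {y}

theorem jetCoord_surjective (hy : Function.Surjective (aeval y : MvPolynomial σ R →ₐ[R] A))
    (n : ℕ) : Function.Surjective (jetCoord B y n) := by
  have hX (s : Fin (n + 1) × A) : JetAlg.mk B A n (X s) ∈ (jetCoord B y n).range := by
    obtain ⟨i, a⟩ := s
    obtain ⟨P, rfl⟩ := hy a
    let F : JetPoly R σ 0 := rename (fun s => (0, s)) P
    have hF : ren R y 0 F - X (0, aeval y P) ∈ relIdeal R A := by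
      rw [relIdeal, RingHom.mem_ker, map_sub, aeval_X, ren, rename_rename, aeval_rename,
        sub_eq_zero]
      rfl
    refine ⟨deltaIter B (dvd_refl _) n i F, ?_⟩
    have hmem :=
      (isDeltaStable_jetIdeal B (dvd_refl B.unif) (relIdeal R A)).deltaIter_sub_mem hF n i
    rw [deltaIter_X, ← ren_deltaIter, ← JetAlg.mk_eq_zero, map_sub, sub_eq_zero] at hmem
    exact (jetCoord_apply B y n _).trans hmem
  intro z
  obtain ⟨F, rfl⟩ : ∃ F, JetAlg.mk B A n F = z := Ideal.Quotient.mk_surjective z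
  change _ ∈ (jetCoord B y n).range
  induction F using MvPolynomial.induction_on with
  | C a => rw [algHom_C]; exact Subalgebra.algebraMap_mem _ a
  | add F G hF hG => rw [map_add]; exact add_mem hF hG
  | mul_X F s hF => rw [map_mul]; exact mul_mem hF (hX s)

end JetCoordinates

section Growth

variable {R τ : Type} [CommRing R] (ϖ : R) (w : τ → ℕ) {K : ℕ} (hK : 0 < K)

/-- The polynomials in which the coefficient of a monomial of weight `b` is divisible by
`ϖ ^ ⌈b / K⌉`. -/
def growthSubalgebra : Subalgebra R (MvPolynomial τ R) where
  carrier := {P | ∀ α, ϖ ^ (Finsupp.weight w α ⌈/⌉ K) ∣ coeff α P}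
  add_mem' hP hQ α := by rw [coeff_add]; exact dvd_add (hP α) (hQ α)
  mul_mem' {P Q} hP hQ α := by
    classical
    rw [coeff_mul]
    refine Finset.dvd_sum fun β hβ => (pow_dvd_pow _ ?_).trans
      ((pow_add ϖ _ _).symm ▸ mul_dvd_mul (hP β.1) (hQ β.2))
    rw [ceilDiv_le_iff_le_mul hK, ← Finset.HasAntidiagonal.mem_antidiagonal.1 hβ, map_add, mul_add]
    exact add_le_add ((ceilDiv_le_iff_le_mul hK).1 le_rfl) ((ceilDiv_le_iff_le_mul hK).1 le_rfl)
  algebraMap_mem' c α := by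
    classical
    rw [algebraMap_eq, coeff_C]
    split_ifs with h
    · rw [← h, map_zero, zero_ceilDiv, pow_zero]
      exact one_dvd _
    · exact dvd_zero _

variable {ϖ w}

theorem X_mem_growthSubalgebra {t : τ} (ht : w t = 0) : X t ∈ growthSubalgebra ϖ w hK := by
  classical
  intro α
  rw [coeff_X]
  split_ifs with h
  · rw [← h, Finsupp.weight_single, ht, smul_zero, zero_ceilDiv, pow_zero]
  · exact dvd_zero _

theorem C_pow_mul_mem_growthSubalgebra {Q : MvPolynomial τ R}
    (hQ : ∀ α ∈ Q.support, Finsupp.weight w α ≤ K) {m : ℕ} (hm : 1 ≤ m) :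
    C (ϖ ^ m) * Q ∈ growthSubalgebra ϖ w hK := by
  intro α
  rw [coeff_C_mul]
  by_cases hα : α ∈ Q.support
  · refine (pow_dvd_pow _ ?_).mul_right _
    rw [ceilDiv_le_iff_le_mul hK]
    exact (hQ α hα).trans (Nat.le_mul_of_pos_right _ hm)
  · rw [notMem_support_iff.1 hα, mul_zero]
    exact dvd_zero _

end Growth

theorem pow_dvd_of_pow_add_mul_eq_zero {S : Type} [CommRing S] {x a u t : S} {e : ℕ}
    (hu : IsUnit u) (h : x ^ e + a * (x * t + u) = 0) : x ^ e ∣ a := by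
  suffices ∀ k ≤ e, x ^ k ∣ a from this e le_rfl
  intro k
  induction k with
  | zero => exact fun _ => pow_zero x ▸ one_dvd a
  | succ k ih =>
    intro hk
    have hau : a * u = -(x ^ e + a * x * t) := by linear_combination h
    rw [← hu.dvd_mul_right, hau, dvd_neg]
    refine dvd_add (pow_dvd_pow _ hk) (Dvd.dvd.mul_right ?_ _)
    rw [pow_succ]
    exact mul_dvd_mul_right (ih (Nat.le_of_succ_le hk)) x

section Uniformizer

variable {p : ℕ} [Fact p.Prime] (E : EisensteinPoly p)

theorem EisensteinPoly.exists_poly_eq_X_pow_add : ∃ Q : Polynomial ℤ_[p], IsUnit (Q.coeff 0) ∧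
    E.poly = .X ^ E.poly.natDegree + .C (p : ℤ_[p]) * Q := by
  have hdvd : Polynomial.C (p : ℤ_[p]) ∣ E.poly - .X ^ E.poly.natDegree := by
    rw [Polynomial.C_dvd_iff_dvd_coeff]
    intro i
    rw [Polynomial.coeff_sub, Polynomial.coeff_X_pow]
    rcases lt_trichotomy i E.poly.natDegree with hi | rfl | hi
    · rw [if_neg hi.ne, sub_zero]
      exact Ideal.mem_span_singleton.1 (E.eisenstein.mem hi)
    · rw [if_pos rfl, E.monic.coeff_natDegree, sub_self]
      exact dvd_zero _
    · rw [if_neg hi.ne', Polynomial.coeff_eq_zero_of_natDegree_lt hi, sub_zero]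
      exact dvd_zero _
  obtain ⟨Q, hQ⟩ := hdvd
  refine ⟨Q, ?_, by rw [← hQ, add_sub_cancel]⟩
  have hcoeff : E.poly.coeff 0 = p * Q.coeff 0 := by
    have he : 0 ≠ E.poly.natDegree := (two_pos.trans_le E.two_le_natDegree).ne
    rw [← Polynomial.coeff_C_mul, ← hQ, Polynomial.coeff_sub, Polynomial.coeff_X_pow, if_neg he,
      sub_zero]
  by_contra hunit
  have hp : (p : ℤ_[p]) ∣ Q.coeff 0 := by
    rw [← Ideal.mem_span_singleton, ← PadicInt.maximalIdeal_eq_span_p]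
    exact hunit
  apply E.eisenstein.notMem
  rw [Ideal.span_singleton_pow, Ideal.mem_span_singleton, hcoeff, pow_two]
  exact mul_dvd_mul_left _ hp

namespace Rpi

theorem exists_unif_pow_add_eq_zero : ∃ t u : Rpi E, IsUnit u ∧
    unif E ^ E.poly.natDegree + p * (unif E * t + u) = 0 := by
  obtain ⟨Q, hunit, hQ⟩ := E.exists_poly_eq_X_pow_add
  let ψ : Polynomial ℤ_[p] →+* Rpi E :=
    (AdjoinRoot.mk E.polyRp).comp (Polynomial.mapRingHom (padicToRp p))
  have hX : ψ .X = unif E := by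
    rw [RingHom.comp_apply, Polynomial.coe_mapRingHom, Polynomial.map_X, AdjoinRoot.mk_X, unif]
  refine ⟨ψ Q.divX, ψ (.C (Q.coeff 0)), (hunit.map Polynomial.C).map ψ, ?_⟩
  have hpoly : ψ E.poly = 0 := AdjoinRoot.mk_self
  rw [hQ, ← Q.X_mul_divX_add] at hpoly
  simpa only [map_add, map_mul, map_pow, hX, map_natCast] using hpoly

theorem p_dvd_unif_pow : (p : Rpi E) ∣ unif E ^ E.poly.natDegree := by
  obtain ⟨t, u, -, h⟩ := exists_unif_pow_add_eq_zero E
  rw [eq_neg_of_add_eq_zero_left h, dvd_neg]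
  exact dvd_mul_right _ _

theorem unif_pow_dvd_p : unif E ^ E.poly.natDegree ∣ (p : Rpi E) := by
  obtain ⟨t, u, hu, h⟩ := exists_unif_pow_add_eq_zero E
  exact pow_dvd_of_pow_add_mul_eq_zero hu h

theorem frob_unif : frob E (unif E) = unif E := by
  rw [frob, unif, AdjoinRoot.lift_root]

end Rpi

end Uniformizer

section Functional

variable {R S : Type} [CommRing R] [CommRing S] [Algebra R S] (lam : S →ₗ[R] R)

/-- The linear map `lam ⊗ 1 : S ⊗ D → D` given by a functional `lam` on `S`; for the trace it is
`arithTrace`. -/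
def applyLeft (D : Type) [CommRing D] [Algebra R D] : S ⊗[R] D →ₗ[R] D :=
  TensorProduct.lid R D ∘ₗ LinearMap.rTensor D lam

variable {D D' : Type} [CommRing D] [Algebra R D] [CommRing D'] [Algebra R D']

theorem applyLeft_tmul (a : S) (x : D) : applyLeft lam D (a ⊗ₜ x) = lam a • x := by
  rw [applyLeft, LinearMap.comp_apply, LinearMap.rTensor_tmul, LinearEquiv.coe_coe,
    TensorProduct.lid_tmul]

theorem applyLeft_map (u : D →ₐ[R] D') (z : S ⊗[R] D) :
    applyLeft lam D' (Algebra.TensorProduct.map (AlgHom.id R S) u z) = u (applyLeft lam D z) := by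
  induction z with
  | zero => simp only [map_zero]
  | tmul a x => rw [Algebra.TensorProduct.map_tmul, applyLeft_tmul, applyLeft_tmul, map_smul,
      AlgHom.id_apply]
  | add y z hy hz => simp only [map_add, hy, hz]

theorem coeff_applyLeft_algebraTensorAlgEquiv_symm {τ : Type} (P : MvPolynomial τ S)
    (α : τ →₀ ℕ) : coeff α (applyLeft lam _ ((algebraTensorAlgEquiv R S).symm P)) =
      lam (coeff α P) := by
  classical
  induction P using MvPolynomial.induction_on' with
  | monomial β a =>
    rw [algebraTensorAlgEquiv_symm_monomial, applyLeft_tmul, coeff_smul, coeff_monomial,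
      coeff_monomial, smul_eq_mul, mul_ite, mul_one, mul_zero, apply_ite lam, map_zero]
  | add P Q hP hQ => simp only [map_add, coeff_add, hP, hQ]

theorem pow_dvd_map_of_pow_dvd {q : R} {ϖ c : S} {e m : ℕ} (hq : algebraMap R S q ∣ ϖ ^ e)
    (hc : ϖ ^ m ∣ c) : q ^ (m / e) ∣ lam c := by
  have hqc : algebraMap R S (q ^ (m / e)) ∣ c := by
    rw [map_pow]
    refine (pow_dvd_pow_of_dvd hq _).trans (Dvd.dvd.trans ?_ hc)
    rw [← pow_mul]
    exact pow_dvd_pow _ (Nat.mul_div_le m e)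
  obtain ⟨t, rfl⟩ := hqc
  rw [← Algebra.smul_def, map_smul, smul_eq_mul]
  exact dvd_mul_right _ _

end Functional

theorem exists_adjoinRoot_linearMap_one_eq_one {R : Type} [CommRing R] {f : Polynomial R}
    (hf : f.Monic) (hdeg : 0 < f.natDegree) : ∃ lam : AdjoinRoot f →ₗ[R] R, lam 1 = 1 := by
  nontriviality R
  refine ⟨Polynomial.lcoeff R 0 ∘ₗ AdjoinRoot.modByMonicHom hf, ?_⟩
  rw [LinearMap.comp_apply, ← map_one (AdjoinRoot.mk f), AdjoinRoot.modByMonicHom_mk,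
    (Polynomial.modByMonic_eq_self_iff hf).2, Polynomial.lcoeff_apply, Polynomial.coeff_one_zero]
  rw [Polynomial.degree_one]
  exact Polynomial.natDegree_pos_iff_degree_pos.1 hdeg

section TensorCoordinates

variable {R S τ : Type} [CommRing R] [CommRing S] [Algebra R S]
  {D : Type} [CommRing D] [Algebra R D]

theorem map_algebraTensorAlgEquiv_symm (u : MvPolynomial τ R →ₐ[R] D) (P : MvPolynomial τ S) :
    Algebra.TensorProduct.map (AlgHom.id R S) u ((algebraTensorAlgEquiv R S).symm P) =
      aeval (fun t => (1 : S) ⊗ₜ[R] u (X t)) P := by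
  have h : (Algebra.TensorProduct.map (AlgHom.id S S) u).comp
      (algebraTensorAlgEquiv R S).symm.toAlgHom = aeval fun t => (1 : S) ⊗ₜ[R] u (X t) := by
    ext t
    rw [aeval_X]
    change Algebra.TensorProduct.map (AlgHom.id S S) u ((algebraTensorAlgEquiv R S).symm (X t)) = _
    rw [algebraTensorAlgEquiv_symm_X, Algebra.TensorProduct.map_tmul, AlgHom.id_apply]
  exact DFunLike.congr_fun h P

variable (S) in
theorem aeval_one_tmul_surjective {x : τ → D}
    (hx : Function.Surjective (aeval x : MvPolynomial τ R →ₐ[R] D)) :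
    Function.Surjective (aeval (fun t => (1 : S) ⊗ₜ[R] x t) : MvPolynomial τ S →ₐ[S] S ⊗[R] D) := by
  intro z
  obtain ⟨y, rfl⟩ := TensorProduct.map_surjective (g := LinearMap.id)
    (g' := (aeval x : MvPolynomial τ R →ₐ[R] D).toLinearMap) Function.surjective_id hx z
  obtain ⟨P, rfl⟩ := (algebraTensorAlgEquiv R S).symm.surjective y
  refine ⟨P, ?_⟩
  have h := map_algebraTensorAlgEquiv_symm (aeval x : MvPolynomial τ R →ₐ[R] D) P
  simp only [aeval_X] at h
  exact h.symm

end TensorCoordinates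

section Comparison

variable {p : ℕ} [Fact p.Prime] (E : EisensteinPoly p) {σ : Type}

/-- The substitution of `δ_π ⁱ x_s`, written as a polynomial in the `δ_p ˡ x_s` over `R_π`, for the
jet variable `(i, s)`. -/
def deltaPiSubst (σ : Type) (n : ℕ) : JetPoly (Rpi E) σ n →ₐ[Rpi E] JetPoly (Rpi E) σ n :=
  aeval fun t => deltaIter (basePi E) (basePi E).dvd_p n t.1 (X (0, t.2))

theorem deltaPiSubst_mem_growthSubalgebra {r : ℕ} (hr : r < E.poly.natDegree)
    (hK : 0 < p ^ (r - 1)) (G : JetPoly (Rpi E) σ r) :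
    deltaPiSubst E σ r G ∈ growthSubalgebra (Rpi.unif E) (derWeight r σ) hK := by
  suffices (deltaPiSubst E σ r).range ≤ growthSubalgebra (Rpi.unif E) (derWeight r σ) hK from
    this ⟨G, rfl⟩
  rw [deltaPiSubst, ← Algebra.adjoin_range_eq_range_aeval, Algebra.adjoin_le_iff]
  rintro _ ⟨⟨i, s⟩, rfl⟩
  cases i using Fin.cases with
  | zero =>
    change deltaIter _ _ r 0 _ ∈ _
    rw [deltaIter_zero_X]
    exact X_mem_growthSubalgebra hK (if_pos rfl)
  | succ k =>
    obtain ⟨Q, hQ, hdeg⟩ := exists_deltaIter_succ_X_eq (basePi E).dvd_p (Rpi.frob_unif E)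
      (Rpi.unif_pow_dvd_p E) s k (k.2.trans hr)
    change deltaIter _ _ r k.succ _ ∈ _
    rw [hQ]
    refine C_pow_mul_mem_growthSubalgebra hK (fun α hα => ?_) (by omega)
    calc Finsupp.weight (derWeight r σ) α ≤ α.degree := weight_derWeight_le_degree α
      _ ≤ Q.totalDegree := le_totalDegree hα
      _ ≤ p ^ (k : ℕ) := hdeg
      _ ≤ p ^ (r - 1) := Nat.pow_le_pow_right (Fact.out : p.Prime).pos (by omega)

variable (A : Type) [CommRing A] [Algebra (Rp p) A]

theorem isDeltaStable_extIdeal :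
    IsDeltaStable (basePi E) (basePi E).dvd_p (fun n => extIdeal E A n) where
  incl_mem hF := (extIdeal_stable E A _ hF).1
  delta_mem hF := (extIdeal_stable E A _ hF).2

theorem iterDelta_eq_deltaIter (n : ℕ) (i : Fin (n + 1)) (b : Rpi E ⊗[Rp p] A) :
    iterDelta E A n i b = deltaIter (basePi E) (basePi E).dvd_p n i
      (Function.surjInv (kappa_surjective E A) b) := by
  induction n with
  | zero => rfl
  | succ n ih =>
    cases i using Fin.cases with
    | zero => rw [deltaIter_zero, ← ih, ← iterDelta_castSucc, Fin.castSucc_zero]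
    | succ j => rw [iterDelta_succ, ih, deltaIter_succ]

variable {A}

theorem iterDelta_one_tmul_sub_mem_extIdeal (a : A) (n : ℕ) (i : Fin (n + 1)) :
    iterDelta E A n i (1 ⊗ₜ a) -
      deltaIter (basePi E) (basePi E).dvd_p n i (X (0, a)) ∈ extIdeal E A n := by
  rw [iterDelta_eq_deltaIter]
  refine (isDeltaStable_extIdeal E A).deltaIter_sub_mem (ker_kappa_le E A ?_) n i
  rw [RingHom.mem_ker, map_sub, Function.surjInv_eq (kappa_surjective E A), kappa, aeval_X,
    sub_self]

theorem toPJetAlg_jetCoord (x : σ → A) (n : ℕ) (G : JetPoly (Rpi E) σ n) :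
    toPJetAlg E A n (jetCoord (basePi E) (fun s => (1 : Rpi E) ⊗ₜ[Rp p] x s) n G) =
      Algebra.TensorProduct.map (AlgHom.id (Rp p) (Rpi E)) (jetCoord (baseP p) x n)
        ((algebraTensorAlgEquiv (Rp p) (Rpi E)).symm (deltaPiSubst E σ n G)) := by
  rw [map_algebraTensorAlgEquiv_symm, ← AlgHom.comp_apply, ← AlgHom.comp_apply]
  congr 1
  ext t
  rw [AlgHom.comp_apply, AlgHom.comp_apply, jetCoord_X, deltaPiSubst, aeval_X]
  have hker := extIdeal_le_ker E A n (iterDelta_one_tmul_sub_mem_extIdeal E (x t.2) n t.1)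
  rw [RingHom.mem_ker, map_sub, sub_eq_zero] at hker
  calc toPJetAlg E A n (JetAlg.mk (basePi E) (Rpi E ⊗[Rp p] A) n (X (t.1, 1 ⊗ₜ x t.2)))
      = toTensor E A n (theta E A n (X (t.1, 1 ⊗ₜ x t.2))) := rfl
    _ = toTensor E A n (iterDelta E A n t.1 (1 ⊗ₜ x t.2)) := by rw [theta, aeval_X]
    _ = toTensor E A n (ren (Rpi E) x n
          (deltaIter (basePi E) (basePi E).dvd_p n t.1 (X (0, t.2)))) := by
        rw [hker, ren_deltaIter, ren_X]
    _ = _ := by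
        rw [toTensor, ren, aeval_rename]
        simp only [jetCoord_X]
        rfl

theorem applyLeft_toPJetAlg_jetCoord (lam : Rpi E →ₗ[Rp p] Rp p) (x : σ → A) (n : ℕ)
    (G : JetPoly (Rpi E) σ n) :
    applyLeft lam _ (toPJetAlg E A n
        (jetCoord (basePi E) (fun s => (1 : Rpi E) ⊗ₜ[Rp p] x s) n G)) =
      jetCoord (baseP p) x n
        (applyLeft lam _ ((algebraTensorAlgEquiv (Rp p) (Rpi E)).symm (deltaPiSubst E σ n G))) := by
  rw [toPJetAlg_jetCoord, applyLeft_map]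

end Comparison

section Affine

variable {p : ℕ} [Fact p.Prime]

theorem logb_mul_sub_one_le_ceilDiv_div {K e : ℕ} (hK : 0 < K) (he : 0 < e) (b : ℕ) :
    Real.logb p ((p : ℝ) ^ (((K : ℝ) * e)⁻¹)) * b - 1 ≤ ((b ⌈/⌉ K) / e : ℕ) := by
  have hp : 1 < (p : ℝ) := mod_cast (Fact.out : p.Prime).one_lt
  have hb : b ≤ K * e * ((b ⌈/⌉ K) / e + 1) := by
    rw [mul_assoc]
    exact ((ceilDiv_le_iff_le_mul hK).1 le_rfl).trans
      (Nat.mul_le_mul_left _ (Nat.lt_mul_div_succ _ he).le)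
  rw [Real.logb_rpow (zero_lt_one.trans hp) hp.ne', sub_le_iff_le_add,
    inv_mul_le_iff₀ (by positivity)]
  exact_mod_cast hb

variable {A : Type} [CommRing A] [Algebra (Rp p) A] {d r : ℕ} {x : Fin d → A}

theorem applyLeft_toPJet_map_jetCoord_algebraMap (E : EisensteinPoly p) (lam : Rpi E →ₗ[Rp p] Rp p)
    (G : JetPoly (Rpi E) (Fin d) r) :
    applyLeft lam _ (toPJet E A r (PHat.map p
        (jetCoord (basePi E) (fun s => (1 : Rpi E) ⊗ₜ[Rp p] x s) r).toRingHom
        (algebraMap _ _ G))) =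
      affineJetMap x r (algebraMap _ _
        (applyLeft lam _
          ((algebraTensorAlgEquiv (Rp p) (Rpi E)).symm (deltaPiSubst E (Fin d) r G)))) := by
  rw [PHat.map_algebraMap, toPJet, PHat.lift_algebraMap, affineJetMap, PHat.map_algebraMap]
  exact (applyLeft_map lam (PHat.of p) (toPJetAlg E A r _)).trans
    (congrArg (PHat.of p) (applyLeft_toPJetAlg_jetCoord E lam x r G))

theorem exists_isOverconvergentSeries_affineJetMap_eq_applyLeft (E : EisensteinPoly p)
    (hr : r < E.poly.natDegree)
    (hx : Function.Surjective (aeval x : MvPolynomial (Fin d) (Rp p) →ₐ[Rp p] A))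
    (lam : Rpi E →ₗ[Rp p] Rp p) (g : PHat p (JetAlg (basePi E) (Rpi E ⊗[Rp p] A) r)) :
    ∃ G : PHat p (MvPolynomial (Fin (r + 1) × Fin d) (Rp p)),
      IsOverconvergentSeries ((p : ℝ) ^ (((p : ℝ) ^ (r - 1) * (E.poly.natDegree : ℝ))⁻¹))
          (PHat.toSeries G) ∧
        affineJetMap x r G = applyLeft lam _ (toPJet E A r g) := by
  obtain ⟨G₀, rfl⟩ := PHat.map_surjective
    (jetCoord_surjective (basePi E) (aeval_one_tmul_surjective (Rpi E) hx) r) g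
  obtain ⟨z, hz⟩ := PHat.exists_hasAdicSum_algebraMap G₀
  let w (k : ℕ) : JetPoly (Rp p) (Fin d) r := applyLeft lam _
    ((algebraTensorAlgEquiv (Rp p) (Rpi E)).symm (deltaPiSubst E (Fin d) r (z k)))
  obtain ⟨G, hG⟩ := exists_hasAdicSum p fun k => algebraMap _ (PHat p (JetPoly (Rp p) (Fin d) r))
    (w k)
  have hK : 0 < p ^ (r - 1) := pow_pos (Fact.out : p.Prime).pos _
  refine ⟨G, isOverconvergentSeries_iff.2 ⟨1, zero_lt_one, fun α =>
    ⟨(Finsupp.weight (derWeight r (Fin d)) α ⌈/⌉ p ^ (r - 1)) / E.poly.natDegree, ?_,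
      (hG.coeff_toSeries α).pow_dvd fun k => Dvd.dvd.mul_left ?_ _⟩⟩, ?_⟩
  · exact_mod_cast logb_mul_sub_one_le_ceilDiv_div (p := p) hK (Nat.zero_lt_of_lt hr) _
  · rw [coeff_applyLeft_algebraTensorAlgEquiv_symm]
    exact pow_dvd_map_of_pow_dvd lam (by simpa using Rpi.p_dvd_unif_pow E)
      (deltaPiSubst_mem_growthSubalgebra E hr hK (z k) α)
  · refine HasAdicSum.unique (hG.map (affineJetMap x r).toAddMonoidHom) ?_
    have h := hz.map ((applyLeft lam _).toAddMonoidHom.comp ((toPJet E A r).comp (PHat.map p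
        (jetCoord (basePi E) (fun s => (1 : Rpi E) ⊗ₜ[Rp p] x s) r).toRingHom)).toAddMonoidHom)
    convert h using 2 with k
    · exact (applyLeft_toPJet_map_jetCoord_algebraMap E lam (z k)).symm
    · rfl

theorem exists_isOverconvergentSeries_affineJetMap_eq_of_pow_mul {ρ : ℝ} {ν : ℕ}
    (hx : Function.Surjective (aeval x : MvPolynomial (Fin d) (Rp p) →ₐ[Rp p] A))
    {f : PHat p (JetAlg (baseP p) A r)} {G : PHat p (MvPolynomial (Fin (r + 1) × Fin d) (Rp p))}
    (hG : IsOverconvergentSeries ρ (PHat.toSeries G))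
    (hGf : affineJetMap x r G = (p : PHat p _) ^ ν * f) :
    ∃ F : PHat p (MvPolynomial (Fin (r + 1) × Fin d) (Rp p)),
      IsOverconvergentSeries ρ (PHat.toSeries F) ∧ affineJetMap x r F = f := by
  have hsurj := jetCoord_surjective (baseP p) hx r
  obtain ⟨H, rfl⟩ := PHat.map_surjective (p := p) hsurj f
  have hker : affineJetMap x r ((p : PHat p _) ^ ν * H - G) = 0 := by
    rw [map_sub, hGf, map_mul, map_pow, map_natCast]
    exact sub_self _
  obtain ⟨a, -, y, hy, hay⟩ := PHat.exists_eq_add_of_map_eq_zero hsurj hker ν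
  refine ⟨H - y, .of_pow_mul (p := p) (ν := ν) ?_, ?_⟩
  · have hF : (p : PHat p _) ^ ν * (H - y) = G + algebraMap _ _ a := by
      rw [mul_sub, sub_eq_iff_eq_add, add_assoc, ← hay, add_sub_cancel]
    rw [← map_natCast PHat.toSeries, ← map_pow, ← map_mul, hF, map_add, PHat.toSeries_algebraMap]
    exact hG.add (isOverconvergentSeries_coe a)
  · rw [map_sub]
    exact (congrArg (_ - ·) hy).trans (sub_zero _)

theorem exists_isOverconvergentSeries_of_pow_mul_eq_applyLeft (E : EisensteinPoly p)
    (hr : r < E.poly.natDegree)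
    (hx : Function.Surjective (aeval x : MvPolynomial (Fin d) (Rp p) →ₐ[Rp p] A))
    (lam : Rpi E →ₗ[Rp p] Rp p) {g : PHat p (JetAlg (basePi E) (Rpi E ⊗[Rp p] A) r)} {ν : ℕ}
    {f : PHat p (JetAlg (baseP p) A r)}
    (h : applyLeft lam _ (toPJet E A r g) = (p : PHat p _) ^ ν * f) :
    ∃ (F : MvPowerSeries (Fin (r + 1) × Fin d) (Rp p)) (hF : IsRestrictedSeries F),
      IsOverconvergentSeries ((p : ℝ) ^ (((p : ℝ) ^ (r - 1) * (E.poly.natDegree : ℝ))⁻¹)) F ∧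
        affineJetMap x r hF.toPHat = f := by
  obtain ⟨G, hG, hGg⟩ := exists_isOverconvergentSeries_affineJetMap_eq_applyLeft E hr hx lam g
  obtain ⟨F, hF, hFf⟩ :=
    exists_isOverconvergentSeries_affineJetMap_eq_of_pow_mul hx hG (hGg.trans h)
  exact ⟨_, isRestrictedSeries_toSeries F, hF, by rw [toPHat_toSeries, hFf]⟩

end Affine

section Embedding

open AlgebraicGeometry CategoryTheory

theorem eval₂Hom_coord_surjective (R : CommRingCat.{0}) (ι : Type) :
    Function.Surjective (eval₂Hom ((Scheme.ΓSpecIso R).inv ≫ (𝔸(ι; Spec R) ↘ Spec R).appTop).hom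
      (AffineSpace.coord (Spec R))) := by
  have hiso : IsIso (AffineSpace.SpecIso ι R).hom.appTop :=
    inferInstanceAs (IsIso (Scheme.Γ.map (AffineSpace.SpecIso ι R).hom.op))
  have h : IsIso ((Scheme.ΓSpecIso _).inv ≫ (AffineSpace.SpecIso ι R).hom.appTop) :=
    IsIso.comp_isIso' inferInstance hiso
  rw [AffineSpace.SpecIso_hom_appTop, Iso.inv_hom_id_assoc] at h
  exact ((ConcreteCategory.isIso_iff_bijective _).1 h).2

variable {R : Type} [CommRing R] {V : Scheme.{0}} {s : V ⟶ Spec (CommRingCat.of R)}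
  {W : V.Opens}

theorem appTop_comp_topIso_eq_algebraMap {X : Scheme.{0}} {q : X ⟶ Spec (CommRingCat.of R)}
    {j : (W : Scheme) ⟶ X} (hj : j ≫ q = W.ι ≫ s) :
    (((Scheme.ΓSpecIso (CommRingCat.of R)).inv ≫ q.appTop) ≫ j.appTop ≫ W.topIso.hom).hom =
      algebraMap R (Sec s W) := by
  have hι : W.ι.appTop ≫ W.topIso.hom = V.presheaf.map (homOfLE (le_top : W ≤ ⊤)).op := by
    rw [Scheme.Opens.ι_appTop]
    exact (V.presheaf.map_comp _ _).symm
  have h := congrArg Scheme.Hom.appTop hj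
  rw [Scheme.Hom.comp_appTop, Scheme.Hom.comp_appTop] at h
  rw [Category.assoc, reassoc_of% h, hι]
  rfl

variable {p : ℕ} [Fact p.Prime] {V : Scheme.{0}} {s : V ⟶ Spec (CommRingCat.of (Rp p))}
  {W : V.Opens} {d : ℕ} {j : (W : Scheme) ⟶ 𝔸(Fin d; Spec (CommRingCat.of (Rp p)))}

theorem aeval_embCoord_surjective [IsClosedImmersion j]
    (hj : j ≫ (𝔸(Fin d; Spec (CommRingCat.of (Rp p))) ↘ Spec (CommRingCat.of (Rp p))) =
      W.ι ≫ s) :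
    Function.Surjective
      (aeval (embCoord s W j) : MvPolynomial (Fin d) (Rp p) →ₐ[Rp p] Sec s W) := by
  have hjs : Function.Surjective (j.appTop ≫ W.topIso.hom) :=
    (ConcreteCategory.bijective_of_isIso W.topIso.hom).2.comp
      (IsClosedImmersion.isAffine_surjective_of_isAffine j).2
  have hcomp : (j.appTop ≫ W.topIso.hom).hom.comp (eval₂Hom
      ((Scheme.ΓSpecIso _).inv ≫ (𝔸(Fin d; Spec (.of (Rp p))) ↘ Spec (.of (Rp p))).appTop).hom
      (AffineSpace.coord _)) = (aeval (embCoord s W j)).toRingHom := by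
    refine ringHom_ext (fun c => ?_) fun i => ?_
    · rw [RingHom.comp_apply, eval₂Hom_C]
      exact (DFunLike.congr_fun (appTop_comp_topIso_eq_algebraMap hj) c).trans
        (algHom_C (aeval (embCoord s W j)) c).symm
    · rw [RingHom.comp_apply, eval₂Hom_X']
      exact (aeval_X (embCoord s W j) i).symm
  intro a
  obtain ⟨P, rfl⟩ := (hjs.comp (eval₂Hom_coord_surjective (.of (Rp p)) (Fin d))) a
  exact ⟨P, (DFunLike.congr_fun hcomp P).symm⟩

end Embedding

end ArithJet

end

theorem proposition2p9_general (p : ℕ) [Fact p.Prime] (E : ArithJet.EisensteinPoly p)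
    (V : AlgebraicGeometry.Scheme.{0})
    (s : V ⟶ AlgebraicGeometry.Spec (CommRingCat.of (ArithJet.Rp p)))
    (r : ℕ) (hr : r < E.poly.natDegree)
    (f : ArithJet.pJetFunctions s r) (hf : ArithJet.IsDeltaPiOverconvergent s E f) :
    ArithJet.IsDeltaPOverconvergent s
      ((p : ℝ) ^ (((p : ℝ) ^ (r - 1) * (E.poly.natDegree : ℝ))⁻¹)) f := by
  intro W d j hclosed hj
  have hx := ArithJet.aeval_embCoord_surjective hj
  rcases hf with ⟨ν, g, hg⟩ | ⟨ν, g, hg⟩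
  · exact ArithJet.exists_isOverconvergentSeries_of_pow_mul_eq_applyLeft E hr hx
      (Algebra.trace _ _) (hg W)
  · have hdeg : E.polyRp.natDegree = E.poly.natDegree := E.monic.natDegree_map _
    obtain ⟨lam, hlam⟩ := ArithJet.exists_adjoinRoot_linearMap_one_eq_one
      (ArithJet.monic_polyRp E) (hdeg ▸ Nat.zero_lt_of_lt hr)
    refine ArithJet.exists_isOverconvergentSeries_of_pow_mul_eq_applyLeft E hr hx lam
      (g := g.1 W) (ν := ν) ?_
    rw [hg W, ArithJet.applyLeft_tmul, hlam, one_smul]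

theorem proposition2p9 (p : ℕ) [Fact p.Prime] (E : ArithJet.EisensteinPoly p)
    (V : AlgebraicGeometry.Scheme.{0})
    (s : V ⟶ AlgebraicGeometry.Spec (CommRingCat.of (ArithJet.Rp p)))
    [AlgebraicGeometry.Smooth s] (r : ℕ) (hr : 1 ≤ r) (hre : r ≤ E.poly.natDegree - 1)
    (f : ArithJet.pJetFunctions s r) (hf : ArithJet.IsDeltaPiOverconvergent s E f) :
    ArithJet.IsDeltaPOverconvergent s
      ((p : ℝ) ^ (((p : ℝ) ^ (r - 1) * (E.poly.natDegree : ℝ))⁻¹)) f :=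
  proposition2p9_general p E V s r (by omega) f hf
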